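/- Let $l\in\mathbb{N}-\frac12=\{\frac12,\frac32,\frac52,\dots\}$. Let $\tilde{\mathfrak g}=\tilde{\mathfrak g}^{(l)}$ be the complex Lie algebra with basis $e,h,f,p_0,\dots,p_{2l},z$ and bracket $$[h,e]=2e,\quad [h,f]=-2f,\quad [e,f]=h,\quad [h,p_k]=2(l-k)p_k,\quad [e,p_k]=kp_{k-1},\quad [f,p_k]=(2l-k)p_{k+1},$$ $$[z,\tilde{\mathfrak g}]=0,\qquad [p_k,p_{k'}]=\delta_{k+k',2l}(-1)^{k+l+\frac12}\,k!\,(2l-k)!\,z ,$$ let $\tilde{\mathcal H}=\tilde{\mathcal H}^{(l)}$ be its Heisenberg subalgebra spanned by $z$ and the $p_k$, and let $U(\tilde{\mathcal H})_{(z)}$ be the localization of the universal enveloping algebra of $\tilde{\mathcal H}$ at the powers of $z$. Modules are complex vector spaces of arbitrary dimension. A simple module is said to have nonzero central charge if $z$ does not act on it as zero (equivalently, $z$ acts as a nonzero scalar). For an $\tilde{\mathcal H}$-module $M$, let $M^{\tilde{\mathfrak g}}$ be the $\tilde{\mathfrak g}$-module obtained from $U(\tilde{\mathcal H})_{(z)}\otimes_{U(\tilde{\mathcal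 H})}M$ by pulling back along the homomorphism $U(\tilde{\mathfrak g})\to U(\tilde{\mathcal H})_{(z)}$ which is the identity on $\tilde{\mathcal H}$ and sends $$e\mapsto\frac1z\sum_{k=1}^{2l}(-1)^{k+l+\frac12}\frac{l-k}{(k-1)!(2l-k)!}\,p_{k-1}p_{2l-k},\qquad f\mapsto\frac1z\sum_{k=1}^{2l}(-1)^{k+l-\frac12}\frac{l-k}{(k-1)!(2l-k)!}\,p_kp_{2l-k+1},$$ $$h\mapsto\frac2z\sum_{k=0}^{l-\frac12}(-1)^{k+l-\frac12}\frac{l-k}{k!(2l-k)!}\,p_{2l-k}p_k-\frac{(l+\frac12)^2}{2}.$$ For an $\mathfrak{sl}_2$-module $N$, let $N^{\tilde{\mathfrak g}}$ be the $\tilde{\mathfrak g}$-module on the same space on which $e,h,f$ act as on $N$ and $\tilde{\mathcal H}$ acts by zero. 1. If $M$ is a simple $\tilde{\mathcal H}$-module with nonzero central charge and $N$ is a simple $\mathfrak{sl}_2$-module, then $M^{\tilde{\mathfrak g}}\otimes N^{\tilde{\mathfrak g}}$ is a simple $\tilde{\mathfrak g}$-module. 2. Let $V$ be a simple $\tilde{\mathfrak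 g}$-module with nonzero central charge. If the restriction of $V$ to $\tilde{\mathcal H}$ contains a simple submodule $M$, then $V\cong M^{\tilde{\mathfrak g}}\otimes N^{\tilde{\mathfrak g}}$ as $\tilde{\mathfrak g}$-modules for some simple $\mathfrak{sl}_2$-module $N$. -/

import Mathlib

open scoped TensorProduct Nat

universe u v w


/-- The centrally extended conformal Galilei algebra `g~^(l)` for the half-integer `l = n + 1/2`,
`n = 0, 1, 2, …` (so that `2 l = 2 n + 1`). The element `⟨a, b, c, v, t⟩` stands for
`a e + b h + c f + ∑ k, v k p_k + t z`, where `k` runs through `0, …, 2 l`. The Lie bracket is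
defined below; `lie_H_E`, `lie_H_F`, `lie_E_F`, `lie_H_P`, `lie_E_P`, `lie_F_P`, `lie_Z` and
`lie_P_P` give its values on the basis. -/
@[ext] structure Galilei (n : ℕ) where
  e : ℂ
  h : ℂ
  f : ℂ
  p : Fin (2 * n + 2) → ℂ
  z : ℂ

namespace Galilei

variable {n : ℕ}

/-- The underlying vector space structure is the componentwise one. -/
def toProd : Galilei n ≃ ℂ × ℂ × ℂ × (Fin (2 * n + 2) → ℂ) × ℂ where
  toFun x := (x.e, x.h, x.f, x.p, x.z)
  invFun y := ⟨y.1, y.2.1, y.2.2.1, y.2.2.2.1, y.2.2.2.2⟩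
  left_inv _ := rfl
  right_inv _ := rfl

instance : AddCommGroup (Galilei n) := toProd.addCommGroup
instance : Module ℂ (Galilei n) := toProd.module ℂ

@[simp] theorem add_e (x y : Galilei n) : (x + y).e = x.e + y.e := rfl
@[simp] theorem add_h (x y : Galilei n) : (x + y).h = x.h + y.h := rfl
@[simp] theorem add_f (x y : Galilei n) : (x + y).f = x.f + y.f := rfl
@[simp] theorem add_p (x y : Galilei n) : (x + y).p = x.p + y.p := rfl
@[simp] theorem add_z (x y : Galilei n) : (x + y).z = x.z + y.z := rfl
@[simp] theorem smul_e (c : ℂ) (x : Galilei n) : (c • x).e = c * x.e := rfl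
@[simp] theorem smul_h (c : ℂ) (x : Galilei n) : (c • x).h = c * x.h := rfl
@[simp] theorem smul_f (c : ℂ) (x : Galilei n) : (c • x).f = c * x.f := rfl
@[simp] theorem smul_p (c : ℂ) (x : Galilei n) : (c • x).p = c • x.p := rfl
@[simp] theorem smul_z (c : ℂ) (x : Galilei n) : (c • x).z = c * x.z := rfl
@[simp] theorem zero_e : (0 : Galilei n).e = 0 := rfl
@[simp] theorem zero_h : (0 : Galilei n).h = 0 := rfl
@[simp] theorem zero_f : (0 : Galilei n).f = 0 := rfl
@[simp] theorem zero_p : (0 : Galilei n).p = 0 := rfl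
@[simp] theorem zero_z : (0 : Galilei n).z = 0 := rfl

/-- The coefficient `v k`, extended by zero to all natural numbers `k`. -/
def coeff (v : Fin (2 * n + 2) → ℂ) (k : ℕ) : ℂ :=
  if hk : k < 2 * n + 2 then v ⟨k, hk⟩ else 0

/-- The coefficients of `[a e + b h + c f, ∑ k, v k • p k]`. -/
def act (a b c : ℂ) (v : Fin (2 * n + 2) → ℂ) : Fin (2 * n + 2) → ℂ := fun j =>
  a * ((j : ℕ) + 1) * coeff v ((j : ℕ) + 1) + b * (2 * n + 1 - 2 * (j : ℕ)) * v j +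
    c * (2 * n + 2 - (j : ℕ)) * (if (j : ℕ) = 0 then 0 else coeff v ((j : ℕ) - 1))

/-- The coefficient of `z` in `[∑ k, v k • p k, ∑ k, w k • p k]`. -/
def form (v w : Fin (2 * n + 2) → ℂ) : ℂ :=
  ∑ k : Fin (2 * n + 2),
    (-1) ^ ((k : ℕ) + n + 1) * ((k : ℕ)! : ℂ) * ((2 * n + 1 - (k : ℕ))! : ℂ) * v k * w k.rev

theorem coeff_add (v w : Fin (2 * n + 2) → ℂ) (k : ℕ) :
    coeff (v + w) k = coeff v k + coeff w k := by
  unfold coeff; split_ifs <;> simp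

theorem coeff_smul (a : ℂ) (v : Fin (2 * n + 2) → ℂ) (k : ℕ) :
    coeff (a • v) k = a * coeff v k := by
  unfold coeff; split_ifs <;> simp

theorem act_add (a b c : ℂ) (v w : Fin (2 * n + 2) → ℂ) :
    act a b c (v + w) = act a b c v + act a b c w := by
  funext j; simp only [act, coeff_add, Pi.add_apply]; split_ifs <;> ring

theorem act_smul (a b c r : ℂ) (v : Fin (2 * n + 2) → ℂ) :
    act a b c (r • v) = r • act a b c v := by
  funext j; simp only [act, coeff_smul, Pi.smul_apply, smul_eq_mul]; split_ifs <;> ring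

theorem act_add_left (a b c a' b' c' : ℂ) (v : Fin (2 * n + 2) → ℂ) :
    act (a + a') (b + b') (c + c') v = act a b c v + act a' b' c' v := by
  funext j; simp only [act, Pi.add_apply]; ring

theorem act_smul_left (a b c r : ℂ) (v : Fin (2 * n + 2) → ℂ) :
    act (r * a) (r * b) (r * c) v = r • act a b c v := by
  funext j; simp only [act, Pi.smul_apply, smul_eq_mul]; ring

theorem coeff_coe (v : Fin (2 * n + 2) → ℂ) (k : Fin (2 * n + 2)) : coeff v (k : ℕ) = v k := by
  simp [coeff]

theorem coeff_of_lt (v : Fin (2 * n + 2) → ℂ) {k : ℕ} (hk : k < 2 * n + 2) :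
    coeff v k = v ⟨k, hk⟩ := by
  simp [coeff, hk]

theorem coeff_of_le (v : Fin (2 * n + 2) → ℂ) {k : ℕ} (hk : 2 * n + 2 ≤ k) : coeff v k = 0 := by
  simp [coeff, hk]

theorem coeff_act (a b c : ℂ) (v : Fin (2 * n + 2) → ℂ) {k : ℕ} (hk : k ≤ 2 * n + 2) :
    coeff (act a b c v) k = a * (k + 1) * coeff v (k + 1) + b * (2 * n + 1 - 2 * k) * coeff v k +
      c * (2 * n + 2 - k) * (if k = 0 then 0 else coeff v (k - 1)) := by
  rcases hk.lt_or_eq with h | rfl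
  · rw [coeff_of_lt _ h, coeff_of_lt v h]
    rfl
  · rw [coeff_of_le _ le_rfl, coeff_of_le _ le_rfl, coeff_of_le _ (Nat.le_succ _)]
    push_cast
    ring

theorem act_act (a b c a' b' c' : ℂ) (v : Fin (2 * n + 2) → ℂ) :
    act a b c (act a' b' c' v) - act a' b' c' (act a b c v) =
      act (2 * (b * a' - a * b')) (a * c' - c * a') (-2 * (b * c' - c * b')) v := by
  funext j
  obtain ⟨j, hj⟩ := j
  rw [Pi.sub_apply, ← coeff_of_lt (act a b c (act a' b' c' v)) hj,
    ← coeff_of_lt (act a' b' c' (act a b c v)) hj, ← coeff_of_lt (act _ _ _ v) hj]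
  rcases j with _ | j
  · simp (disch := omega) only [coeff_act, if_true, zero_add]
    simp
    ring
  · simp (disch := omega) only [coeff_act, Nat.add_sub_cancel, Nat.succ_ne_zero, if_false]
    push_cast
    rcases j with _ | j
    · simp only [if_true]; push_cast; ring
    · simp only [Nat.add_sub_cancel, Nat.succ_ne_zero, if_false]; push_cast; ring

theorem sum_fin_eq (g : ℕ → ℂ) : ∑ k : Fin (2 * n + 2), g k = ∑ k ∈ Finset.range (2 * n + 2), g k :=
  Fin.sum_univ_eq_sum_range g _

theorem form_eq (v w : Fin (2 * n + 2) → ℂ) : form v w = ∑ k ∈ Finset.range (2 * n + 2),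
    (-1) ^ (k + n + 1) * (k ! : ℂ) * ((2 * n + 1 - k)! : ℂ) * coeff v k *
      coeff w (2 * n + 1 - k) := by
  rw [← sum_fin_eq]
  refine Finset.sum_congr rfl fun k _ => ?_
  rw [← coeff_coe v, ← coeff_coe w, Fin.val_rev]
  congr 2
  omega

theorem form_add_left (u v w : Fin (2 * n + 2) → ℂ) : form (u + v) w = form u w + form v w := by
  simp only [form, Pi.add_apply, ← Finset.sum_add_distrib]
  exact Finset.sum_congr rfl fun _ _ => by ring

theorem form_add_right (u v w : Fin (2 * n + 2) → ℂ) : form u (v + w) = form u v + form u w := by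
  simp only [form, Pi.add_apply, ← Finset.sum_add_distrib]
  exact Finset.sum_congr rfl fun _ _ => by ring

theorem form_smul_right (r : ℂ) (u v : Fin (2 * n + 2) → ℂ) : form u (r • v) = r * form u v := by
  simp only [form, Pi.smul_apply, smul_eq_mul, Finset.mul_sum]
  exact Finset.sum_congr rfl fun _ _ => by ring

theorem form_swap (v w : Fin (2 * n + 2) → ℂ) : form v w = - form w v := by
  unfold form
  rw [← Equiv.sum_comp Fin.revPerm, ← Finset.sum_neg_distrib]
  refine Finset.sum_congr rfl fun k _ => ?_
  obtain ⟨k, hk⟩ := k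
  simp only [Fin.revPerm_apply, Fin.rev_rev, Fin.val_rev]
  have h1 : 2 * n + 2 - (k + 1) = 2 * n + 1 - k := by omega
  have h2 : 2 * n + 1 - (2 * n + 1 - k) = k := by omega
  have h3 : ((-1 : ℂ)) ^ (2 * n + 1 - k + n + 1) = - (-1) ^ (k + n + 1) := by
    have : 2 * n + 1 - k + n + 1 + (k + n + 1) = 2 * (2 * n + 1) + 1 := by omega
    have h4 : ((-1 : ℂ)) ^ (2 * n + 1 - k + n + 1) * (-1) ^ (k + n + 1) = -1 := by
      rw [← pow_add, this, pow_succ, pow_mul]; simp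
    have h5 : ((-1 : ℂ)) ^ (k + n + 1) * (-1) ^ (k + n + 1) = 1 := by
      rw [← mul_pow]; simp
    linear_combination ((-1 : ℂ)) ^ (k + n + 1) * h4 - ((-1 : ℂ)) ^ (2 * n + 1 - k + n + 1) * h5
  rw [h1, h2, h3]
  ring

theorem form_act (a b c : ℂ) (v w : Fin (2 * n + 2) → ℂ) :
    form (act a b c v) w + form v (act a b c w) = 0 := by
  set s : ℕ → ℂ := fun k => (-1) ^ (k + n + 1) * (k ! : ℂ) * ((2 * n + 1 - k)! : ℂ) with hs
  have hs1 : ∀ k, k < 2 * n + 1 → s k * (k + 1) = - (s (k + 1) * (2 * n + 1 - k)) := by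
    intro k hk
    obtain ⟨m, hm⟩ := Nat.exists_eq_add_of_lt hk
    have h1 : 2 * n + 1 - k = m + 1 := by omega
    have h2 : 2 * n + 1 - (k + 1) = m := by omega
    have h3 : (2 * n + 1 - k : ℂ) = m + 1 := by
      have : ((2 * n + 1 : ℕ) : ℂ) = ((k + m + 1 : ℕ) : ℂ) := by rw [hm]
      push_cast at this
      linear_combination this
    simp only [hs, h1, h2, h3, Nat.factorial_succ]
    push_cast
    ring
  have hA : form (act a b c v) w + form v (act a b c w) =
      a * (∑ k ∈ Finset.range (2 * n + 2), s k * (k + 1) * coeff v (k + 1) * coeff w (2 * n + 1 - k)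
        + ∑ k ∈ Finset.range (2 * n + 2), s k * (2 * n + 2 - k) * coeff v k *
            coeff w (2 * n + 1 - k + 1)) +
      c * (∑ k ∈ Finset.range (2 * n + 2), s k * (2 * n + 2 - k) *
            (if k = 0 then 0 else coeff v (k - 1)) * coeff w (2 * n + 1 - k)
        + ∑ k ∈ Finset.range (2 * n + 2), s k * (k + 1) * coeff v k *
            (if 2 * n + 1 - k = 0 then 0 else coeff w (2 * n + 1 - k - 1))) := by
    simp only [form_eq, ← Finset.sum_add_distrib, Finset.mul_sum]
    refine Finset.sum_congr rfl fun k hk => ?_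
    have hk' := Finset.mem_range.1 hk
    rw [coeff_act _ _ _ _ hk'.le, coeff_act _ _ _ _ (by omega : 2 * n + 1 - k ≤ 2 * n + 2)]
    have h3 : ((2 * n + 1 - k : ℕ) : ℂ) = 2 * n + 1 - k := by
      rw [Nat.cast_sub (by omega)]; push_cast; ring
    rw [h3]
    simp only [hs]
    ring
  rw [hA]
  have h1 : ∑ k ∈ Finset.range (2 * n + 2), s k * (k + 1) * coeff v (k + 1) *
      coeff w (2 * n + 1 - k) + ∑ k ∈ Finset.range (2 * n + 2), s k * (2 * n + 2 - k) * coeff v k *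
            coeff w (2 * n + 1 - k + 1) = 0 := by
    rw [Finset.sum_range_succ, Finset.sum_range_succ' _ (2 * n + 1),
      coeff_of_le v (by omega : 2 * n + 2 ≤ 2 * n + 1 + 1),
      coeff_of_le w (by omega : 2 * n + 2 ≤ 2 * n + 1 - 0 + 1), mul_zero, zero_mul, mul_zero,
      add_zero, add_zero, ← Finset.sum_add_distrib]
    refine Finset.sum_eq_zero fun k hk => ?_
    have hk' := Finset.mem_range.1 hk
    rw [hs1 k hk', (by omega : 2 * n + 1 - (k + 1) + 1 = 2 * n + 1 - k)]
    push_cast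
    ring
  have h2 : ∑ k ∈ Finset.range (2 * n + 2), s k * (2 * n + 2 - k) *
            (if k = 0 then 0 else coeff v (k - 1)) * coeff w (2 * n + 1 - k)
        + ∑ k ∈ Finset.range (2 * n + 2), s k * (k + 1) * coeff v k *
            (if 2 * n + 1 - k = 0 then 0 else coeff w (2 * n + 1 - k - 1)) = 0 := by
    rw [Finset.sum_range_succ' _ (2 * n + 1), Finset.sum_range_succ _ (2 * n + 1),
      if_pos rfl, if_pos (Nat.sub_self _), mul_zero, zero_mul, mul_zero,
      add_zero, add_zero, ← Finset.sum_add_distrib]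
    refine Finset.sum_eq_zero fun k hk => ?_
    have hk' := Finset.mem_range.1 hk
    rw [hs1 k hk', if_neg (Nat.succ_ne_zero k), if_neg (by omega), Nat.add_sub_cancel,
      (by omega : 2 * n + 1 - (k + 1) = 2 * n + 1 - k - 1)]
    push_cast
    ring
  rw [h1, h2, mul_zero, mul_zero, add_zero]

instance : Bracket (Galilei n) (Galilei n) where
  bracket x y :=
    { e := 2 * (x.h * y.e - x.e * y.h)
      h := x.e * y.f - x.f * y.e
      f := -2 * (x.h * y.f - x.f * y.h)
      p := act x.e x.h x.f y.p - act y.e y.h y.f x.p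
      z := form x.p y.p }

@[simp] theorem lie_e (x y : Galilei n) : ⁅x, y⁆.e = 2 * (x.h * y.e - x.e * y.h) := rfl
@[simp] theorem lie_h (x y : Galilei n) : ⁅x, y⁆.h = x.e * y.f - x.f * y.e := rfl
@[simp] theorem lie_f (x y : Galilei n) : ⁅x, y⁆.f = -2 * (x.h * y.f - x.f * y.h) := rfl
@[simp] theorem lie_p (x y : Galilei n) :
    ⁅x, y⁆.p = act x.e x.h x.f y.p - act y.e y.h y.f x.p := rfl
@[simp] theorem lie_z (x y : Galilei n) : ⁅x, y⁆.z = form x.p y.p := rfl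

theorem form_sub_left (u v w : Fin (2 * n + 2) → ℂ) : form (u - v) w = form u w - form v w := by
  rw [eq_sub_iff_add_eq, ← form_add_left, sub_add_cancel]

theorem form_sub_right (u v w : Fin (2 * n + 2) → ℂ) : form u (v - w) = form u v - form u w := by
  rw [eq_sub_iff_add_eq, ← form_add_right, sub_add_cancel]

theorem act_sub (a b c : ℂ) (v w : Fin (2 * n + 2) → ℂ) :
    act a b c (v - w) = act a b c v - act a b c w := by
  rw [eq_sub_iff_add_eq, ← act_add, sub_add_cancel]

instance : LieRing (Galilei n) where
  add_lie x y t := by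
    ext : 1 <;> simp only [lie_e, lie_h, lie_f, lie_p, lie_z, add_e, add_h, add_f, add_p, add_z,
      form_add_left, act_add, act_add_left]
    · ring
    · ring
    · ring
    · abel
  lie_add x y t := by
    ext : 1 <;> simp only [lie_e, lie_h, lie_f, lie_p, lie_z, add_e, add_h, add_f, add_p, add_z,
      form_add_right, act_add, act_add_left]
    · ring
    · ring
    · ring
    · abel
  lie_self x := by
    ext : 1 <;> simp only [lie_e, lie_h, lie_f, lie_p, lie_z, zero_e, zero_h, zero_f, zero_p,
      zero_z, sub_self]
    · ring
    · ring
    · ring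
    · have := form_swap x.p x.p
      linear_combination this / 2
  leibniz_lie x y t := by
    ext : 1 <;> simp only [lie_e, lie_h, lie_f, lie_p, lie_z, add_e, add_h, add_f, add_p, add_z,
      form_sub_left, form_sub_right, act_sub]
    · ring
    · ring
    · ring
    · rw [← act_act x.e x.h x.f y.e y.h y.f, ← act_act x.e x.h x.f t.e t.h t.f,
        ← act_act y.e y.h y.f t.e t.h t.f]
      abel
    · have h1 := form_act x.e x.h x.f y.p t.p
      have h2 := form_act y.e y.h y.f x.p t.p
      have h3 := form_act t.e t.h t.f x.p y.p
      have h4 := form_swap (act t.e t.h t.f x.p) y.p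
      linear_combination h2 - h1 - h3 + h4

instance : LieAlgebra ℂ (Galilei n) where
  lie_smul r x y := by
    ext : 1 <;> simp only [lie_e, lie_h, lie_f, lie_p, lie_z, smul_e, smul_h, smul_f, smul_p,
      smul_z, form_smul_right, act_smul, act_smul_left, smul_sub]
    · ring
    · ring
    · ring


/-- The basis vector `e`. -/
def E : Galilei n := ⟨1, 0, 0, 0, 0⟩
/-- The basis vector `h`. -/
def H : Galilei n := ⟨0, 1, 0, 0, 0⟩
/-- The basis vector `f`. -/
def F : Galilei n := ⟨0, 0, 1, 0, 0⟩
/-- The central basis vector `z`. -/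
def Z : Galilei n := ⟨0, 0, 0, 0, 1⟩
/-- The basis vector `p_k` for `0 ≤ k ≤ 2 n + 1`; by convention `P k = 0` for all other `k`. -/
def P (k : ℕ) : Galilei n := ⟨0, 0, 0, fun j => if (j : ℕ) = k then 1 else 0, 0⟩

theorem coeff_single {k j : ℕ} : coeff (n := n) (fun j => if (j : ℕ) = k then 1 else 0) j =
    if j = k ∧ k < 2 * n + 2 then 1 else 0 := by
  unfold coeff
  by_cases h : j < 2 * n + 2
  · simp only [h, dif_pos]
    exact if_congr (by omega) rfl rfl
  · rw [dif_neg h, if_neg (by omega)]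

theorem act_zero (a b c : ℂ) : act (n := n) a b c 0 = 0 := by
  simpa using act_smul (n := n) a b c 0 0

theorem act_zero_left (v : Fin (2 * n + 2) → ℂ) : act 0 0 0 v = 0 := by
  simpa using act_smul_left (n := n) 0 0 0 0 v

theorem form_zero_left (v : Fin (2 * n + 2) → ℂ) : form 0 v = 0 := by simp [form]
theorem form_zero_right (v : Fin (2 * n + 2) → ℂ) : form v 0 = 0 := by simp [form]

theorem lie_H_E : ⁅(H : Galilei n), (E : Galilei n)⁆ = (2 : ℂ) • E := by
  ext : 1 <;> simp [H, E, act_zero, form_zero_left]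

theorem lie_H_F : ⁅(H : Galilei n), (F : Galilei n)⁆ = (-2 : ℂ) • F := by
  ext : 1 <;> simp only [lie_e, lie_h, lie_f, lie_p, lie_z, smul_e, smul_h, smul_f, smul_p, smul_z]
    <;> simp [H, F, act_zero, form_zero_left]

theorem lie_E_F : ⁅(E : Galilei n), (F : Galilei n)⁆ = H := by
  ext : 1 <;> simp [H, E, F, act_zero, form_zero_left]

theorem lie_H_P (k : ℕ) : ⁅(H : Galilei n), (P k : Galilei n)⁆ = (2 * n + 1 - 2 * k : ℂ) • P k := by
  ext j <;> simp [H, P, act, form_zero_left]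
  split_ifs with h <;> simp [h]

theorem lie_E_P (k : ℕ) (hk : k < 2 * n + 2) :
    ⁅(E : Galilei n), (P k : Galilei n)⁆ = (k : ℂ) • P (k - 1) := by
  ext j <;> simp [E, P, act, form_zero_left, coeff_single, hk]
  rcases k with _ | k
  · simp
  · simp
    split_ifs with h <;> simp [h]

theorem lie_F_P (k : ℕ) (hk : k < 2 * n + 2) :
    ⁅(F : Galilei n), (P k : Galilei n)⁆ = (2 * n + 1 - k : ℂ) • P (k + 1) := by
  ext j <;> simp [F, P, act, form_zero_left, coeff_single, hk]
  obtain ⟨j, hj⟩ := j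
  rcases j with _ | j
  · simp
  · simp
    split_ifs with h <;> simp [h]
    ring

theorem lie_Z (x : Galilei n) : ⁅(Z : Galilei n), x⁆ = 0 := by
  ext : 1 <;> simp [Z, act_zero, act_zero_left, form_zero_left]

theorem lie_P_P (k k' : ℕ) (hk : k < 2 * n + 2) (hk' : k' < 2 * n + 2) :
    ⁅(P k : Galilei n), (P k' : Galilei n)⁆ = if k + k' = 2 * n + 1 then
      ((-1) ^ (k + n + 1) * (k ! : ℂ) * ((2 * n + 1 - k)! : ℂ)) • Z else 0 := by
  have h : form (P k : Galilei n).p (P k' : Galilei n).p = if k + k' = 2 * n + 1 then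
      ((-1) ^ (k + n + 1) * (k ! : ℂ) * ((2 * n + 1 - k)! : ℂ)) else 0 := by
    rw [form_eq, Finset.sum_eq_single k]
    · have h1 : (2 * n + 1 - k = k' ∧ k' < 2 * n + 2) ↔ k + k' = 2 * n + 1 := by omega
      simp only [P, coeff_single, hk, and_self, if_true, h1]
      split_ifs <;> simp
    · intro j _ hj
      simp [P, coeff_single, hj]
    · intro h; exact absurd (Finset.mem_range.2 hk) h
  ext : 1
  · split_ifs <;> simp [P, Z]
  · split_ifs <;> simp [P, Z]
  · split_ifs <;> simp [P, Z]
  · rw [lie_p]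
    split_ifs <;> simp [P, Z, act_zero_left]
  · rw [lie_z, h]
    split_ifs <;> simp [Z]

theorem eq_sum (x : Galilei n) : x = x.e • E + x.h • H + x.f • F +
    ∑ k : Fin (2 * n + 2), x.p k • P (k : ℕ) + x.z • Z := by
  have hs : ∀ s : Finset (Fin (2 * n + 2)), (∑ k ∈ s, x.p k • (P (k : ℕ) : Galilei n)) =
      ⟨0, 0, 0, fun j => if j ∈ s then x.p j else 0, 0⟩ := by
    intro s
    induction s using Finset.induction_on with
    | empty => rfl
    | insert a s ha ih =>
      rw [Finset.sum_insert ha, ih]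
      ext j <;> simp [P]
      by_cases hj : j = a
      · subst hj; simp [ha]
      · simp [hj, Fin.val_inj]
  rw [hs]
  ext : 1 <;> simp [Z, E, H, F]

/-- The Heisenberg subalgebra `H~^(l)`, consisting of the linear combinations of `z` and the
`p_k`, see `heis_eq_span`. -/
def heis (n : ℕ) : LieSubalgebra ℂ (Galilei n) where
  carrier := {x | x.e = 0 ∧ x.h = 0 ∧ x.f = 0}
  add_mem' := by rintro x y ⟨h1, h2, h3⟩ ⟨h4, h5, h6⟩; simp [h1, h2, h3, h4, h5, h6]
  zero_mem' := ⟨rfl, rfl, rfl⟩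
  smul_mem' := by rintro c x ⟨h1, h2, h3⟩; simp [h1, h2, h3]
  lie_mem' := by rintro x y ⟨h1, h2, h3⟩ ⟨h4, h5, h6⟩; simp [h1, h2, h3, h4, h5, h6]

theorem heis_eq_span : (heis n).toSubmodule =
    Submodule.span ℂ (insert Z (Set.range fun k : Fin (2 * n + 2) => P (k : ℕ))) := by
  apply le_antisymm
  · rintro x ⟨h1, h2, h3⟩
    rw [eq_sum x, h1, h2, h3, zero_smul, zero_smul, zero_smul, zero_add, zero_add, zero_add]
    exact add_mem (sum_mem fun k _ => Submodule.smul_mem _ _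
        (Submodule.subset_span (Set.mem_insert_of_mem _ ⟨k, rfl⟩)))
      (Submodule.smul_mem _ _ (Submodule.subset_span (Set.mem_insert _ _)))
  · rw [Submodule.span_le]
    rintro x (rfl | ⟨k, rfl⟩) <;> exact ⟨rfl, rfl, rfl⟩

/-- The Lie algebra `sl_2` of traceless `2 × 2` complex matrices. -/
abbrev sl2 := LieAlgebra.SpecialLinear.sl (Fin 2) ℂ

section
attribute [local instance 100] LieRing.ofAssociativeRing

/-- The element `a e + b h + c f` of `sl_2`. -/
def sl2Mk (a b c : ℂ) : sl2 := ⟨!![b, a; c, -b], by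
  change Matrix.trace !![b, a; c, -b] = 0
  rw [Matrix.trace_fin_two_of, add_neg_cancel]⟩

/-- The projection of the Galilei algebra onto `sl_2` with kernel the Heisenberg subalgebra,
`e ↦ !![0, 1; 0, 0]`, `h ↦ !![1, 0; 0, -1]`, `f ↦ !![0, 0; 1, 0]`. -/
def toSl2 (n : ℕ) : Galilei n →ₗ⁅ℂ⁆ sl2 where
  toFun x := sl2Mk x.e x.h x.f
  map_add' x y := Subtype.ext (by
    change (!![_, _; _, _] : Matrix (Fin 2) (Fin 2) ℂ) = !![_, _; _, _] + !![_, _; _, _]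
    rw [← Matrix.ext_iff]
    simp [Fin.forall_fin_two, add_comm])
  map_smul' c x := Subtype.ext (by
    change (!![_, _; _, _] : Matrix (Fin 2) (Fin 2) ℂ) = c • !![_, _; _, _]
    rw [← Matrix.ext_iff]
    simp [Fin.forall_fin_two])
  map_lie' {x y} := Subtype.ext (by
    rw [LieAlgebra.SpecialLinear.sl_bracket]
    change (!![_, _; _, _] : Matrix (Fin 2) (Fin 2) ℂ) =
      !![_, _; _, _] * !![_, _; _, _] - !![_, _; _, _] * !![_, _; _, _]
    rw [Matrix.mul_fin_two, Matrix.mul_fin_two, ← Matrix.ext_iff]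
    simp only [Fin.forall_fin_two, Matrix.sub_apply, Matrix.of_apply, Matrix.cons_val',
      Matrix.cons_val_zero, Matrix.cons_val_one, Matrix.cons_val_fin_one, lie_e, lie_h, lie_f]
    refine ⟨⟨?_, ?_⟩, ?_, ?_⟩ <;> ring)
end

end Galilei

/-- The module `N^g~` of an `sl_2`-module `N`: the same space, on which `e`, `h`, `f` act as on `N`
and the Heisenberg subalgebra acts by zero. -/
def Inflation (N : Type*) := N

section
variable (N : Type*) [AddCommGroup N] [Module ℂ N] [LieRingModule Galilei.sl2 N]
  [LieModule ℂ Galilei.sl2 N]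

instance : AddCommGroup (Inflation N) := inferInstanceAs (AddCommGroup N)
instance : Module ℂ (Inflation N) := inferInstanceAs (Module ℂ N)
instance (n : ℕ) : LieRingModule (Galilei n) (Inflation N) :=
  LieRingModule.compLieHom N (Galilei.toSl2 n)
instance (n : ℕ) : LieModule ℂ (Galilei n) (Inflation N) :=
  LieModule.compLieHom N (Galilei.toSl2 n)

end

section Osc0
/-! The elements `E`, `F`, `H` in an associative algebra containing elements `p k` and an
inverse `w` of `z`. Here `l = n + 1/2`, so `2 l = 2 n + 1`, `l + 1/2 = n + 1`, `l - 1/2 = n`. -/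

variable {A : Type*} [Ring A] [Algebra ℂ A] (n : ℕ) (p : ℕ → A) (w : A)

/-- `E = z⁻¹ ∑_{k=1}^{2l} (-1)^(k+l+1/2) (l-k) / ((k-1)! (2l-k)!) p_{k-1} p_{2l-k}` -/
noncomputable def oscE : A := w * ∑ k ∈ Finset.Icc 1 (2 * n + 1),
  ((-1) ^ (k + n + 1) * ((n + 1 / 2 - k) / (((k - 1)! : ℂ) * ((2 * n + 1 - k)! : ℂ)))) •
    (p (k - 1) * p (2 * n + 1 - k))

/-- `F = z⁻¹ ∑_{k=1}^{2l} (-1)^(k+l-1/2) (l-k) / ((k-1)! (2l-k)!) p_k p_{2l-k+1}` -/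
noncomputable def oscF : A := w * ∑ k ∈ Finset.Icc 1 (2 * n + 1),
  ((-1) ^ (k + n) * ((n + 1 / 2 - k) / (((k - 1)! : ℂ) * ((2 * n + 1 - k)! : ℂ)))) •
    (p k * p (2 * n + 1 - k + 1))

/-- `H = 2 z⁻¹ ∑_{k=0}^{l-1/2} (-1)^(k+l-1/2) (l-k) / (k! (2l-k)!) p_{2l-k} p_k - (l+1/2)^2 / 2` -/
noncomputable def oscH : A := (2 : ℂ) • (w * ∑ k ∈ Finset.range (n + 1),
  ((-1) ^ (k + n) * ((n + 1 / 2 - k) / ((k ! : ℂ) * ((2 * n + 1 - k)! : ℂ)))) •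
    (p (2 * n + 1 - k) * p k)) - algebraMap ℂ A ((n + 1) ^ 2 / 2)

end Osc0

theorem sgn_odd {i j : ℕ} (h : Odd (i + j)) : (-1 : ℂ) ^ i * (-1) ^ j = -1 := by
  rw [← pow_add, h.neg_one_pow]

/-- The relations of the Heisenberg algebra with `z` central and `w` inverse to `z`. -/
structure HeisRel {A : Type*} [Ring A] [Algebra ℂ A] (n : ℕ) (p : ℕ → A) (w z : A) : Prop where
  comm : ∀ i j, i < 2 * n + 2 → j < 2 * n + 2 → p i * p j - p j * p i =
    if i + j = 2 * n + 1 then ((-1) ^ (i + n + 1) * (i ! : ℂ) * ((2 * n + 1 - i)! : ℂ)) • z else 0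
  inv : z * w = 1
  central : ∀ a : A, z * a = a * z

section Osc
variable {A : Type*} [Ring A] [Algebra ℂ A] {n : ℕ} {p : ℕ → A} {w z : A}

theorem mul_comm_left {A : Type*} [Ring A] (a b c : A) : a * b * c - c * (a * b) =
    a * (b * c - c * b) + (a * c - c * a) * b := by
  noncomm_ring

theorem mul_comm_right {A : Type*} [Ring A] (c a b : A) : c * (a * b) - a * b * c =
    (c * a - a * c) * b + a * (c * b - b * c) := by
  noncomm_ring

theorem HeisRel.inv' (hr : HeisRel n p w z) : w * z = 1 := by rw [← hr.central, hr.inv]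

theorem HeisRel.centralw (hr : HeisRel n p w z) (a : A) : w * a = a * w := by
  calc w * a = w * a * (z * w) := by rw [hr.inv, mul_one]
    _ = w * (a * z) * w := by simp only [mul_assoc]
    _ = w * z * a * w := by rw [← hr.central]; simp only [mul_assoc]
    _ = a * w := by rw [hr.inv', one_mul]

theorem HeisRel.quad (hr : HeisRel n p w z) (s : Finset ℕ) (c : ℕ → ℂ) (x y : ℕ → A) (a : A) :
    (w * ∑ k ∈ s, c k • (x k * y k)) * a - a * (w * ∑ k ∈ s, c k • (x k * y k)) =
      w * ∑ k ∈ s, c k • (x k * (y k * a - a * y k) + (x k * a - a * x k) * y k) := by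
  rw [← mul_assoc a, ← hr.centralw a, mul_assoc, mul_assoc, ← mul_sub, Finset.sum_mul,
    Finset.mul_sum, ← Finset.sum_sub_distrib]
  congr 1
  refine Finset.sum_congr rfl fun k _ => ?_
  rw [← mul_comm_left, smul_sub, smul_mul_assoc, mul_smul_comm]

theorem HeisRel.E_p (hr : HeisRel n p w z) {i : ℕ} (hi : i < 2 * n + 2) :
    oscE n p w * p i - p i * oscE n p w = (i : ℂ) • p (i - 1) := by
  rw [oscE, hr.quad]
  rcases i with _ | a
  · rw [Finset.sum_eq_zero, mul_zero, Nat.cast_zero, zero_smul]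
    intro k hk
    rw [Finset.mem_Icc] at hk
    rw [hr.comm _ _ (by omega) (by omega), hr.comm _ _ (by omega) (by omega),
      if_neg (by omega), if_neg (by omega)]
    simp
  obtain ⟨b, hb⟩ : ∃ b, a + b = 2 * n := ⟨2 * n - a, by omega⟩
  have hbC : (n : ℂ) = (a + b) / 2 := by
    have : ((a + b : ℕ) : ℂ) = ((2 * n : ℕ) : ℂ) := by rw [hb]
    push_cast at this
    linear_combination -this / 2
  simp only [smul_add, Finset.sum_add_distrib]
  rw [Finset.sum_eq_single (a + 1), Finset.sum_eq_single (b + 1)]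
  · rw [hr.comm _ _ (by omega) (by omega), hr.comm _ _ (by omega) (by omega), if_pos (by omega),
      if_pos (by omega)]
    have e1 : 2 * n + 1 - (a + 1) = b := by omega
    have e2 : 2 * n + 1 - (b + 1) = a := by omega
    have e3 : 2 * n + 1 - b = a + 1 := by omega
    simp only [e1, e2, e3, Nat.add_sub_cancel]
    rw [mul_smul_comm, smul_mul_assoc, hr.central, smul_smul, smul_smul, ← add_smul, mul_smul_comm,
      ← hr.central, ← mul_assoc w z, hr.inv', one_mul]
    congr 1
    have s1 : (-1 : ℂ) ^ (a + 1 + n + 1) * (-1) ^ (b + n + 1) = -1 :=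
      sgn_odd ⟨2 * n + 1, by omega⟩
    have s2 : (-1 : ℂ) ^ (b + 1 + n + 1) * (-1) ^ (b + n + 1) = -1 :=
      sgn_odd ⟨b + n + 1, by omega⟩
    have fa : (a ! : ℂ) ≠ 0 := by exact_mod_cast a.factorial_ne_zero
    have fb : (b ! : ℂ) ≠ 0 := by exact_mod_cast b.factorial_ne_zero
    rw [Nat.factorial_succ a]
    have t1 : (-1 : ℂ) ^ (a + 1 + n + 1) * ((n + 1 / 2 - (a + 1 : ℕ)) / ((a ! : ℂ) * (b ! : ℂ))) *
        ((-1) ^ (b + n + 1) * (b ! : ℂ) * (((a + 1) * a ! : ℕ) : ℂ)) =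
        -((n + 1 / 2 - (a + 1)) * (a + 1)) := by
      push_cast
      field_simp
      linear_combination ((n * 2 + 1 - 2 * (a + 1)) : ℂ) * s1
    have t2 : (-1 : ℂ) ^ (b + 1 + n + 1) * ((n + 1 / 2 - (b + 1 : ℕ)) / ((b ! : ℂ) * (a ! : ℂ))) *
        ((-1) ^ (b + n + 1) * (b ! : ℂ) * (((a + 1) * a ! : ℕ) : ℂ)) =
        -((n + 1 / 2 - (b + 1)) * (a + 1)) := by
      push_cast
      field_simp
      linear_combination ((n * 2 + 1 - 2 * (b + 1)) : ℂ) * s2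
    rw [t1, t2, hbC]
    push_cast
    ring
  · intro k hk hne
    rw [Finset.mem_Icc] at hk
    rw [hr.comm _ _ (by omega) (by omega), if_neg (by omega), zero_mul, smul_zero]
  · intro h; exact absurd (Finset.mem_Icc.2 (by omega)) h
  · intro k hk hne
    rw [Finset.mem_Icc] at hk
    rw [hr.comm _ _ (by omega) (by omega), if_neg (by omega), mul_zero, smul_zero]
  · intro h; exact absurd (Finset.mem_Icc.2 (by omega)) h

theorem HeisRel.F_p (hr : HeisRel n p w z) {i : ℕ} (hi : i < 2 * n + 2) :
    oscF n p w * p i - p i * oscF n p w = (2 * n + 1 - i : ℂ) • p (i + 1) := by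
  rw [oscF, hr.quad]
  obtain ⟨b, hb⟩ : ∃ b, i + b = 2 * n + 1 := ⟨2 * n + 1 - i, by omega⟩
  have hbC : (n : ℂ) = (i + b - 1) / 2 := by
    have : ((i + b : ℕ) : ℂ) = ((2 * n + 1 : ℕ) : ℂ) := by rw [hb]
    push_cast at this
    linear_combination -this / 2
  rcases b with _ | b
  · rw [Finset.sum_eq_zero, mul_zero, hbC]
    · push_cast
      rw [show (2 * ((i + 0 - 1) / 2) + 1 - i : ℂ) = 0 by ring, zero_smul]
    intro k hk
    rw [Finset.mem_Icc] at hk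
    rw [hr.comm _ _ (by omega) (by omega), hr.comm _ _ (by omega) (by omega),
      if_neg (by omega), if_neg (by omega)]
    simp
  simp only [smul_add, Finset.sum_add_distrib]
  rw [Finset.sum_eq_single (i + 1), Finset.sum_eq_single (b + 1)]
  · rw [hr.comm _ _ (by omega) (by omega), hr.comm _ _ (by omega) (by omega), if_pos (by omega),
      if_pos (by omega)]
    have e1 : 2 * n + 1 - (i + 1) = b := by omega
    have e2 : 2 * n + 1 - (b + 1) = i := by omega
    simp only [e1, e2, Nat.add_sub_cancel]
    rw [mul_smul_comm, smul_mul_assoc, hr.central, smul_smul, smul_smul, ← add_smul, mul_smul_comm,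
      ← hr.central, ← mul_assoc w z, hr.inv', one_mul]
    congr 1
    have s1 : (-1 : ℂ) ^ (i + 1 + n) * (-1) ^ (b + 1 + n + 1) = -1 :=
      sgn_odd ⟨2 * n + 1, by omega⟩
    have s2 : (-1 : ℂ) ^ (b + 1 + n) * (-1) ^ (b + 1 + n + 1) = -1 :=
      sgn_odd ⟨b + n + 1, by omega⟩
    have fa : (i ! : ℂ) ≠ 0 := by exact_mod_cast i.factorial_ne_zero
    have fb : (b ! : ℂ) ≠ 0 := by exact_mod_cast b.factorial_ne_zero
    rw [Nat.factorial_succ b]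
    have t1 : (-1 : ℂ) ^ (i + 1 + n) * ((n + 1 / 2 - (i + 1 : ℕ)) / ((i ! : ℂ) * (b ! : ℂ))) *
        ((-1) ^ (b + 1 + n + 1) * (((b + 1) * b ! : ℕ) : ℂ) * (i ! : ℂ)) =
        -((n + 1 / 2 - (i + 1)) * (b + 1)) := by
      push_cast
      field_simp
      linear_combination ((n * 2 + 1 - 2 * (i + 1)) : ℂ) * s1
    have t2 : (-1 : ℂ) ^ (b + 1 + n) * ((n + 1 / 2 - (b + 1 : ℕ)) / ((b ! : ℂ) * (i ! : ℂ))) *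
        ((-1) ^ (b + 1 + n + 1) * (((b + 1) * b ! : ℕ) : ℂ) * (i ! : ℂ)) =
        -((n + 1 / 2 - (b + 1)) * (b + 1)) := by
      push_cast
      field_simp
      linear_combination ((n * 2 + 1 - 2 * (b + 1)) : ℂ) * s2
    rw [t1, t2, hbC]
    push_cast
    ring
  · intro k hk hne
    rw [Finset.mem_Icc] at hk
    rw [hr.comm _ _ (by omega) (by omega), if_neg (by omega), zero_mul, smul_zero]
  · intro h; exact absurd (Finset.mem_Icc.2 (by omega)) h
  · intro k hk hne
    rw [Finset.mem_Icc] at hk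
    rw [hr.comm _ _ (by omega) (by omega), if_neg (by omega), mul_zero, smul_zero]
  · intro h; exact absurd (Finset.mem_Icc.2 (by omega)) h

theorem sum_range_fold {A : Type*} [Ring A] (m : ℕ) (g : ℕ → A) : ∑ k ∈ Finset.range (2 * m + 2), g k =
    ∑ k ∈ Finset.range (m + 1), (g k + g (2 * m + 1 - k)) := by
  rw [show 2 * m + 2 = (m + 1) + (m + 1) by ring, Finset.sum_range_add, Finset.sum_add_distrib,
    ← Finset.sum_range_reflect (fun k => g (m + 1 + k))]
  congr 1
  refine Finset.sum_congr rfl fun k hk => ?_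
  have := Finset.mem_range.1 hk
  congr 1
  omega

theorem HeisRel.E_F (hr : HeisRel n p w z) :
    oscE n p w * oscF n p w - oscF n p w * oscE n p w = oscH n p w := by
  set u : ℕ → ℂ := fun i => (n + 1 / 2 - i) * i * (2 * n + 2 - i) with hu
  set g : ℕ → ℂ := fun i => (-1) ^ (i + n) / ((i ! : ℂ) * ((2 * n + 1 - i)! : ℂ)) with hg
  have h1 : oscE n p w * oscF n p w - oscF n p w * oscE n p w =
      w * ∑ i ∈ Finset.range (2 * n + 2), (g i * (u i - u (i + 1))) • (p i * p (2 * n + 1 - i)) := by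
    rw [← neg_sub, oscF, hr.quad, ← mul_neg, ← Finset.sum_neg_distrib]
    congr 1
    have h2 : ∀ k ∈ Finset.Icc 1 (2 * n + 1), 
        -(((-1 : ℂ) ^ (k + n) * ((n + 1 / 2 - k) / (((k - 1)! : ℂ) * ((2 * n + 1 - k)! : ℂ)))) •
          (p k * (p (2 * n + 1 - k + 1) * oscE n p w - oscE n p w * p (2 * n + 1 - k + 1)) +
            (p k * oscE n p w - oscE n p w * p k) * p (2 * n + 1 - k + 1))) =
        -(g (k - 1) * u k) • (p (k - 1) * p (2 * n + 1 - (k - 1))) +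
          (g k * u k) • (p k * p (2 * n + 1 - k)) := by
      intro k hk
      rw [Finset.mem_Icc] at hk
      obtain ⟨a, rfl⟩ : ∃ a, k = a + 1 := ⟨k - 1, by omega⟩
      obtain ⟨b, hb⟩ : ∃ b, a + b = 2 * n := ⟨2 * n - a, by omega⟩
      have hbC : (n : ℂ) = (a + b) / 2 := by
        have : ((a + b : ℕ) : ℂ) = ((2 * n : ℕ) : ℂ) := by rw [hb]
        push_cast at this
        linear_combination -this / 2
      rw [← neg_sub (oscE n p w * _), ← neg_sub (oscE n p w * _), hr.E_p (by omega),
        hr.E_p (by omega)]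
      have e1 : 2 * n + 1 - (a + 1) = b := by omega
      have e3 : 2 * n + 1 - a = b + 1 := by omega
      have fa : (a ! : ℂ) ≠ 0 := by exact_mod_cast a.factorial_ne_zero
      have fb : (b ! : ℂ) ≠ 0 := by exact_mod_cast b.factorial_ne_zero
      have ga : (a + 1 : ℂ) ≠ 0 := by exact_mod_cast a.succ_ne_zero
      have gb : (b + 1 : ℂ) ≠ 0 := by exact_mod_cast b.succ_ne_zero
      simp only [Nat.add_sub_cancel, e1, hg, hu, e3, mul_neg, neg_mul, mul_smul_comm,
        smul_mul_assoc, ← neg_add, smul_neg, neg_neg, smul_add, smul_smul]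
      rw [add_comm]
      congr 1
      · congr 1
        rw [hbC, Nat.factorial_succ]
        push_cast
        field_simp
        ring
      · congr 1
        rw [hbC, Nat.factorial_succ]
        push_cast
        field_simp
        ring
    rw [Finset.sum_congr rfl h2, Finset.sum_add_distrib]
    have h3 : Finset.Icc 1 (2 * n + 1) = Finset.Ico 1 (2 * n + 2) := by
      ext; simp only [Finset.mem_Icc, Finset.mem_Ico]; omega
    have h4 : ∑ k ∈ Finset.Icc 1 (2 * n + 1), (g k * u k) • (p k * p (2 * n + 1 - k)) =
        ∑ k ∈ Finset.range (2 * n + 2), (g k * u k) • (p k * p (2 * n + 1 - k)) := by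
      rw [h3, Finset.range_eq_Ico, ← Finset.sum_Ico_consecutive _ (Nat.zero_le 1) (by omega)]
      simp [hu]
    have h5 : ∑ k ∈ Finset.Icc 1 (2 * n + 1), 
          -(g (k - 1) * u k) • (p (k - 1) * p (2 * n + 1 - (k - 1))) =
        ∑ k ∈ Finset.range (2 * n + 2), -(g k * u (k + 1)) • (p k * p (2 * n + 1 - k)) := by
      rw [h3, Finset.sum_Ico_eq_sum_range, Finset.sum_range_succ _ (2 * n + 1)]
      have : u (2 * n + 1 + 1) = 0 := by simp only [hu]; push_cast; ring
      rw [this, mul_zero, neg_zero, zero_smul, add_zero]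
      refine Finset.sum_congr rfl fun k _ => ?_
      rw [Nat.add_sub_cancel_left, add_comm 1 k]
    rw [h4, h5, ← Finset.sum_add_distrib]
    refine Finset.sum_congr rfl fun k _ => ?_
    rw [← add_smul]
    congr 1
    ring
  rw [h1, sum_range_fold]
  have h6 : ∀ i ∈ Finset.range (n + 1),
      (g i * (u i - u (i + 1))) • (p i * p (2 * n + 1 - i)) +
        (g (2 * n + 1 - i) * (u (2 * n + 1 - i) - u (2 * n + 1 - i + 1))) •
          (p (2 * n + 1 - i) * p (2 * n + 1 - (2 * n + 1 - i))) =
      (2 : ℂ) • (((-1 : ℂ) ^ (i + n) *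
        ((n + 1 / 2 - i) / ((i ! : ℂ) * ((2 * n + 1 - i)! : ℂ)))) • (p (2 * n + 1 - i) * p i)) +
        (u (i + 1) - u i) • z := by
    intro i hi
    have hi' := Finset.mem_range.1 hi
    obtain ⟨b, hb⟩ : ∃ b, i + b = 2 * n + 1 := ⟨2 * n + 1 - i, by omega⟩
    have hbC : (n : ℂ) = (i + b - 1) / 2 := by
      have : ((i + b : ℕ) : ℂ) = ((2 * n + 1 : ℕ) : ℂ) := by rw [hb]
      push_cast at this
      linear_combination -this / 2
    have e1 : 2 * n + 1 - i = b := by omega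
    have e2 : 2 * n + 1 - b = i := by omega
    have hc := hr.comm i b (by omega) (by omega)
    rw [if_pos hb, sub_eq_iff_eq_add, e1] at hc
    have fa : (i ! : ℂ) ≠ 0 := by exact_mod_cast i.factorial_ne_zero
    have fb : (b ! : ℂ) ≠ 0 := by exact_mod_cast b.factorial_ne_zero
    have s1 : (-1 : ℂ) ^ (i + n) * (-1) ^ (i + n + 1) = -1 := sgn_odd ⟨i + n, by omega⟩
    have s2 : (-1 : ℂ) ^ (b + n) = - (-1) ^ (i + n) := by
      have h7 : (-1 : ℂ) ^ (i + n) * (-1) ^ (b + n) = -1 := sgn_odd ⟨2 * n, by omega⟩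
      have h8 : (-1 : ℂ) ^ (i + n) * (-1) ^ (i + n) = 1 := by rw [← mul_pow]; simp
      linear_combination (-1 : ℂ) ^ (i + n) * h7 - (-1 : ℂ) ^ (b + n) * h8
    simp only [e1, e2]
    rw [hc, smul_add, add_assoc, ← add_smul, smul_smul, smul_smul, add_comm]
    congr 2
    · simp only [hg, hu, e1, e2, s2]
      rw [hbC]
      push_cast
      field_simp
      ring
    · simp only [hg, e1]
      field_simp
      linear_combination (u i - u (i + 1)) * s1
  rw [Finset.sum_congr rfl h6, Finset.sum_add_distrib, ← Finset.smul_sum, ← Finset.sum_smul,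
    Finset.sum_range_sub, mul_add, mul_smul_comm, mul_smul_comm, hr.inv', oscH,
    Algebra.algebraMap_eq_smul_one, sub_eq_add_neg _ (_ • (1 : A)), ← neg_smul]
  congr 2
  simp only [hu]
  push_cast
  ring

theorem HeisRel.H_p (hr : HeisRel n p w z) {i : ℕ} (hi : i < 2 * n + 2) :
    oscH n p w * p i - p i * oscH n p w = (2 * n + 1 - 2 * i : ℂ) • p i := by
  rw [← hr.E_F]
  have h1 : (oscE n p w * oscF n p w - oscF n p w * oscE n p w) * p i -
      p i * (oscE n p w * oscF n p w - oscF n p w * oscE n p w) =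
      (oscE n p w * (oscF n p w * p i - p i * oscF n p w) -
        (oscF n p w * p i - p i * oscF n p w) * oscE n p w) -
      (oscF n p w * (oscE n p w * p i - p i * oscE n p w) -
        (oscE n p w * p i - p i * oscE n p w) * oscF n p w) := by noncomm_ring
  rw [h1, hr.E_p hi, hr.F_p hi]
  simp only [mul_smul_comm, smul_mul_assoc, ← smul_sub]
  have h2 : (i : ℂ) • (oscF n p w * p (i - 1) - p (i - 1) * oscF n p w) =
      (i * (2 * n + 2 - i) : ℂ) • p i := by
    rcases i with _ | i
    · simp
    · rw [Nat.add_sub_cancel, hr.F_p (by omega), smul_smul]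
      congr 1
      push_cast
      ring
  have h3 : (2 * n + 1 - i : ℂ) • (oscE n p w * p (i + 1) - p (i + 1) * oscE n p w) =
      ((2 * n + 1 - i) * (i + 1) : ℂ) • p i := by
    rcases (Nat.lt_succ_iff.1 hi).lt_or_eq with h | h
    · rw [hr.E_p (by omega), Nat.add_sub_cancel, smul_smul]
      push_cast
      rfl
    · rw [h]
      push_cast
      simp
  rw [h2, h3, ← sub_smul]
  congr 1
  ring

theorem HeisRel.H_E (hr : HeisRel n p w z) :
    oscH n p w * oscE n p w - oscE n p w * oscH n p w = (2 : ℂ) • oscE n p w := by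
  rw [← neg_sub, oscE, hr.quad, ← mul_neg, ← Finset.sum_neg_distrib, ← mul_smul_comm,
    Finset.smul_sum]
  congr 1
  refine Finset.sum_congr rfl fun k hk => ?_
  rw [Finset.mem_Icc] at hk
  rw [← neg_sub (oscH n p w * _), ← neg_sub (oscH n p w * _), hr.H_p (by omega),
    hr.H_p (by omega), smul_comm, ← smul_neg]
  congr 1
  rw [mul_neg, neg_mul, ← neg_add, neg_neg, mul_smul_comm, smul_mul_assoc, ← add_smul]
  congr 1
  rw [Nat.cast_sub hk.1, Nat.cast_sub hk.2]
  push_cast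
  ring

theorem HeisRel.H_F (hr : HeisRel n p w z) :
    oscH n p w * oscF n p w - oscF n p w * oscH n p w = (-2 : ℂ) • oscF n p w := by
  rw [← neg_sub, oscF, hr.quad, ← mul_neg, ← Finset.sum_neg_distrib, ← mul_smul_comm,
    Finset.smul_sum]
  congr 1
  refine Finset.sum_congr rfl fun k hk => ?_
  rw [Finset.mem_Icc] at hk
  rw [← neg_sub (oscH n p w * _), ← neg_sub (oscH n p w * _), hr.H_p (by omega),
    hr.H_p (by omega), smul_comm (-2 : ℂ), ← smul_neg]
  congr 1
  rw [mul_neg, neg_mul, ← neg_add, neg_neg, mul_smul_comm, smul_mul_assoc, ← add_smul]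
  congr 1
  push_cast [Nat.cast_sub hk.2]
  ring
end Osc

section Env
variable (R L M : Type*) [CommRing R] [LieRing L] [LieAlgebra R L] [AddCommGroup M] [Module R M]
  [LieRingModule L M] [LieModule R L M]

/-- The space of the `L`-module `M`, regarded as a (left) module over the universal enveloping algebra
of `L`. -/
def EnvModule (R L M : Type*) [CommRing R] [LieRing L] [LieAlgebra R L] [AddCommGroup M]
    [Module R M] [LieRingModule L M] [LieModule R L M] := M

instance : AddCommGroup (EnvModule R L M) := inferInstanceAs (AddCommGroup M)
instance : Module R (EnvModule R L M) := inferInstanceAs (Module R M)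
noncomputable instance : Module (UniversalEnvelopingAlgebra R L) (EnvModule R L M) :=
  Module.compHom M
    (UniversalEnvelopingAlgebra.lift R (LieModule.toEnd R L M)).toRingHom

theorem EnvModule.smul_def (u : UniversalEnvelopingAlgebra R L) (m : EnvModule R L M) :
    u • m = (UniversalEnvelopingAlgebra.lift R (LieModule.toEnd R L M) u : M →ₗ[R] M) m := rfl

theorem EnvModule.ι_smul (x : L) (m : M) :
    UniversalEnvelopingAlgebra.ι R x • (show EnvModule R L M from m) = ⁅x, m⁆ := by
  rw [EnvModule.smul_def, UniversalEnvelopingAlgebra.lift_ι_apply]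
  rfl

instance : IsScalarTower R (UniversalEnvelopingAlgebra R L) (EnvModule R L M) where
  smul_assoc r u m := by
    rw [EnvModule.smul_def, EnvModule.smul_def, map_smul]
    rfl
end Env

namespace Galilei
variable (n : ℕ)

/-- The universal enveloping algebra of the Heisenberg subalgebra. -/
abbrev UHeis := UniversalEnvelopingAlgebra ℂ (heis n)

/-- `p_k` as an element of the Heisenberg subalgebra. -/
noncomputable def heisP (k : ℕ) : heis n := ⟨P k, rfl, rfl, rfl⟩
/-- `z` as an element of the Heisenberg subalgebra. -/
noncomputable def heisZ : heis n := ⟨Z, rfl, rfl, rfl⟩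

section
attribute [local instance 100] LieRing.ofAssociativeRing

theorem ι_Z_comm (a : UHeis n) : UniversalEnvelopingAlgebra.ι ℂ (heisZ n) * a =
    a * UniversalEnvelopingAlgebra.ι ℂ (heisZ n) := by
  set c := UniversalEnvelopingAlgebra.ι ℂ (heisZ n)
  have h : ∀ a : UHeis n, a ∈ Subalgebra.centralizer ℂ {c} := by
    intro a
    let S := Subalgebra.centralizer ℂ {c}
    have hx : ∀ x : heis n, UniversalEnvelopingAlgebra.ι ℂ x ∈ S := by
      intro x
      rw [Subalgebra.mem_centralizer_iff]
      rintro g rfl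
      rw [← sub_eq_zero, ← LieRing.of_associative_ring_bracket, ← LieHom.map_lie]
      have : ⁅heisZ n, x⁆ = 0 := Subtype.ext (lie_Z x.1)
      rw [this, map_zero]
    let f : heis n →ₗ⁅ℂ⁆ S :=
      { toFun := fun x => ⟨UniversalEnvelopingAlgebra.ι ℂ x, hx x⟩
        map_add' := fun x y => Subtype.ext (map_add _ x y)
        map_smul' := fun r x => Subtype.ext (map_smul _ r x)
        map_lie' := fun {x y} => Subtype.ext (LieHom.map_lie _ x y) }
    have hf : S.val.comp (UniversalEnvelopingAlgebra.lift ℂ f) = AlgHom.id ℂ _ := by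
      apply UniversalEnvelopingAlgebra.hom_ext
      ext x
      simp only [LieHom.comp_apply, AlgHom.coe_toLieHom, AlgHom.comp_apply,
        UniversalEnvelopingAlgebra.lift_ι_apply]
      rfl
    have := DFunLike.congr_fun hf a
    rw [← AlgHom.id_apply (R := ℂ) a, ← this]
    exact Subtype.mem _
  exact Subalgebra.mem_centralizer_iff ℂ |>.1 (h a) c rfl
end

/-- The multiplicative set of the powers `z ^ i`, `i ≥ 0`. -/
noncomputable def zPowers : Submonoid (UHeis n) :=
  Submonoid.powers (UniversalEnvelopingAlgebra.ι ℂ (heisZ n))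

theorem zPowers_comm (s : zPowers n) (r : UHeis n) : (s : UHeis n) * r = r * s := by
  obtain ⟨_, k, rfl⟩ := s
  exact ((show Commute _ r from ι_Z_comm n r).pow_left k).eq

instance : OreLocalization.OreSet (zPowers n) where
  ore_right_cancel r₁ r₂ s h := ⟨s, by rw [zPowers_comm, zPowers_comm, h]⟩
  oreNum r _ := r
  oreDenom _ s := s
  ore_eq r s := zPowers_comm n s r

/-- The localization of `U(H~)` with respect to the powers of `z`. -/
abbrev UHeisLoc := OreLocalization (zPowers n) (UHeis n)

/-- The image of `p_k` in the localization. -/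
noncomputable def locP (k : ℕ) : UHeisLoc n :=
  OreLocalization.numeratorRingHom (UniversalEnvelopingAlgebra.ι ℂ (heisP n k))
/-- The image of `z` in the localization. -/
noncomputable def locZ : UHeisLoc n :=
  OreLocalization.numeratorRingHom (UniversalEnvelopingAlgebra.ι ℂ (heisZ n))
/-- The inverse `1 / z` in the localization. -/
noncomputable def locW : UHeisLoc n :=
  OreLocalization.oreDiv 1 ⟨UniversalEnvelopingAlgebra.ι ℂ (heisZ n), Submonoid.mem_powers _⟩

end Galilei

/-- The linear map with `e ↦ E`, `h ↦ H`, `f ↦ F`, `p_k ↦ p k`, `z ↦ z`. -/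
noncomputable def oscLin {A : Type*} [Ring A] [Algebra ℂ A] (n : ℕ) (p : ℕ → A) (w z : A) :
    Galilei n →ₗ[ℂ] A where
  toFun x := x.e • oscE n p w + x.h • oscH n p w + x.f • oscF n p w +
    ∑ k : Fin (2 * n + 2), x.p k • p k + x.z • z
  map_add' x y := by
    simp only [Galilei.add_e, Galilei.add_h, Galilei.add_f, Galilei.add_p, Galilei.add_z,
      Pi.add_apply, add_smul, Finset.sum_add_distrib]
    abel
  map_smul' c x := by
    simp only [Galilei.smul_e, Galilei.smul_h, Galilei.smul_f, Galilei.smul_p, Galilei.smul_z,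
      Pi.smul_apply, smul_eq_mul, mul_smul, smul_add, Finset.smul_sum, RingHom.id_apply]

section
attribute [local instance 100] LieRing.ofAssociativeRing
open Galilei

theorem oscLin_lie {A : Type*} [Ring A] [Algebra ℂ A] {n : ℕ} {p : ℕ → A} {w z : A}
    (hr : HeisRel n p w z) (x y : Galilei n) :
    oscLin n p w z ⁅x, y⁆ = ⁅oscLin n p w z x, oscLin n p w z y⁆ := by
  set Q : (Fin (2 * n + 2) → ℂ) → A := fun v => ∑ k : Fin (2 * n + 2), v k • p k with hQ
  have hQr : ∀ v, Q v = ∑ k ∈ Finset.range (2 * n + 2), coeff v k • p k := by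
    intro v
    rw [← Fin.sum_univ_eq_sum_range (fun k => coeff v k • p k)]
    simp only [coeff_coe, hQ]
  have hQsub : ∀ v v', Q (v - v') = Q v - Q v' := by
    intro v v'
    simp only [hQ, Pi.sub_apply, sub_smul, Finset.sum_sub_distrib]
  have hz1 : ∀ a : A, ⁅z, a⁆ = 0 := fun a => by
    rw [LieRing.of_associative_ring_bracket, hr.central, sub_self]
  have hz2 : ∀ a : A, ⁅a, z⁆ = 0 := fun a => by
    rw [LieRing.of_associative_ring_bracket, hr.central, sub_self]
  set S : ℂ → ℂ → ℂ → A := fun a b c => a • oscE n p w + b • oscH n p w + c • oscF n p w with hS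
  have hSS : ∀ a b c a' b' c', ⁅S a b c, S a' b' c'⁆ =
      S (2 * (b * a' - a * b')) (a * c' - c * a') (-2 * (b * c' - c * b')) := by
    intro a b c a' b' c'
    have h1 : ⁅oscE n p w, oscF n p w⁆ = oscH n p w := hr.E_F
    have h2 : ⁅oscH n p w, oscE n p w⁆ = (2 : ℂ) • oscE n p w := hr.H_E
    have h3 : ⁅oscH n p w, oscF n p w⁆ = (-2 : ℂ) • oscF n p w := hr.H_F
    have h4 : ⁅oscF n p w, oscE n p w⁆ = - oscH n p w := by rw [← lie_skew, h1]
    have h5 : ⁅oscE n p w, oscH n p w⁆ = -((2 : ℂ) • oscE n p w) := by rw [← lie_skew, h2]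
    have h6 : ⁅oscF n p w, oscH n p w⁆ = -((-2 : ℂ) • oscF n p w) := by rw [← lie_skew, h3]
    simp only [hS, lie_add, add_lie, lie_smul, smul_lie, lie_self, h1, h2, h3, h4, h5, h6]
    module
  have hSQ : ∀ a b c v, ⁅S a b c, Q v⁆ = Q (act a b c v) := by
    intro a b c v
    have h1 : ∀ k, k < 2 * n + 2 → ⁅S a b c, p k⁆ = a • (k : ℂ) • p (k - 1) +
        b • (2 * n + 1 - 2 * k : ℂ) • p k + c • (2 * n + 1 - k : ℂ) • p (k + 1) := by
      intro k hk
      rw [← hr.E_p hk, ← hr.F_p hk, ← hr.H_p hk]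
      simp only [hS, add_lie, smul_lie]
      rfl
    have h2 : ⁅S a b c, Q v⁆ = a • ∑ k ∈ Finset.range (2 * n + 2), (coeff v k * k) • p (k - 1) +
        ∑ k ∈ Finset.range (2 * n + 2), (b * (2 * n + 1 - 2 * k) * coeff v k) • p k +
        c • ∑ k ∈ Finset.range (2 * n + 2), (coeff v k * (2 * n + 1 - k)) • p (k + 1) := by
      rw [hQr, LieRing.of_associative_ring_bracket, Finset.mul_sum, Finset.sum_mul,
        ← Finset.sum_sub_distrib, Finset.smul_sum, Finset.smul_sum, ← Finset.sum_add_distrib,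
        ← Finset.sum_add_distrib]
      refine Finset.sum_congr rfl fun k hk => ?_
      rw [mul_smul_comm, smul_mul_assoc, ← smul_sub, ← LieRing.of_associative_ring_bracket,
        h1 k (Finset.mem_range.1 hk)]
      module
    have h3 : ∑ k ∈ Finset.range (2 * n + 2), (coeff v k * k) • p (k - 1) =
        ∑ k ∈ Finset.range (2 * n + 2), ((k + 1) * coeff v (k + 1)) • p k := by
      rw [Finset.sum_range_succ', Finset.sum_range_succ _ (2 * n + 1),
        coeff_of_le v (by omega : 2 * n + 2 ≤ 2 * n + 1 + 1), Nat.cast_zero, mul_zero, mul_zero,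
        zero_smul, zero_smul]
      congr 1
      refine Finset.sum_congr rfl fun k _ => ?_
      rw [Nat.add_sub_cancel, mul_comm]
      push_cast
      rfl
    have h4 : ∑ k ∈ Finset.range (2 * n + 2), (coeff v k * (2 * n + 1 - k)) • p (k + 1) =
        ∑ k ∈ Finset.range (2 * n + 2),
          ((2 * n + 2 - k) * (if k = 0 then 0 else coeff v (k - 1))) • p k := by
      rw [Finset.sum_range_succ, Finset.sum_range_succ' _ (2 * n + 1), if_pos rfl, mul_zero,
        zero_smul]
      congr 1
      · refine Finset.sum_congr rfl fun k _ => ?_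
        rw [Nat.add_sub_cancel, if_neg (Nat.succ_ne_zero k)]
        congr 1
        push_cast
        ring
      · push_cast
        rw [sub_self, mul_zero, zero_smul]
    rw [h2, h3, h4, hQr, Finset.smul_sum, Finset.smul_sum, ← Finset.sum_add_distrib,
        ← Finset.sum_add_distrib]
    refine Finset.sum_congr rfl fun k hk => ?_
    rw [coeff_act _ _ _ _ (Finset.mem_range.1 hk).le]
    module
  have hQQ : ∀ v v', ⁅Q v, Q v'⁆ = form v v' • z := by
    intro v v'
    rw [hQr, hQr, form_eq, LieRing.of_associative_ring_bracket, Finset.sum_mul_sum,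
      Finset.sum_mul_sum, Finset.sum_comm (s := Finset.range (2 * n + 2)) (f := fun i j =>
        coeff v' i • p i * coeff v j • p j), ← Finset.sum_sub_distrib, Finset.sum_smul]
    refine Finset.sum_congr rfl fun k hk => ?_
    have hk' := Finset.mem_range.1 hk
    rw [← Finset.sum_sub_distrib, Finset.sum_eq_single (2 * n + 1 - k)]
    · rw [smul_mul_smul_comm, smul_mul_smul_comm, mul_comm (coeff v' _), ← smul_sub,
        hr.comm _ _ hk' (by omega), if_pos (by omega), smul_smul]
      congr 1
      ring
    · intro j hj hne
      rw [smul_mul_smul_comm, smul_mul_smul_comm, mul_comm (coeff v' _), ← smul_sub,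
        hr.comm _ _ hk' (Finset.mem_range.1 hj), if_neg (by omega), smul_zero]
    · intro h
      exact absurd (Finset.mem_range.2 (by omega)) h
  have hQS : ∀ a b c v, ⁅Q v, S a b c⁆ = - Q (act a b c v) := by
    intro a b c v
    rw [← lie_skew, hSQ]
  have hL : ∀ x : Galilei n, oscLin n p w z x = S x.e x.h x.f + Q x.p + x.z • z := fun _ => rfl
  rw [hL, hL, hL]
  simp only [lie_add, add_lie, lie_smul, smul_lie, hz1, hz2, hSS, hSQ, hQS, hQQ, smul_zero,
    lie_e, lie_h, lie_f, lie_p, lie_z, hQsub]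
  abel
end

namespace Galilei

section
attribute [local instance 100] LieRing.ofAssociativeRing

theorem numerator_smul (n : ℕ) (c : ℂ) (u : UHeis n) :
    (OreLocalization.numeratorRingHom (c • u) : UHeisLoc n) =
      c • (OreLocalization.numeratorRingHom u : UHeisLoc n) := by
  rw [Algebra.smul_def, map_mul, Algebra.smul_def]
  rfl

theorem heisRel_loc (n : ℕ) : HeisRel n (locP n) (locW n) (locZ n) where
  comm i j hi hj := by
    have h1 : ⁅heisP n i, heisP n j⁆ = if i + j = 2 * n + 1 then
        ((-1) ^ (i + n + 1) * (i ! : ℂ) * ((2 * n + 1 - i)! : ℂ)) • heisZ n else 0 := by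
      apply Subtype.ext
      rw [LieSubalgebra.coe_bracket]
      change ⁅(P i : Galilei n), (P j : Galilei n)⁆ = _
      rw [lie_P_P i j hi hj]
      split_ifs <;> rfl
    have h2 : UniversalEnvelopingAlgebra.ι ℂ (heisP n i) * UniversalEnvelopingAlgebra.ι ℂ (heisP n j)
        - UniversalEnvelopingAlgebra.ι ℂ (heisP n j) * UniversalEnvelopingAlgebra.ι ℂ (heisP n i) =
        UniversalEnvelopingAlgebra.ι ℂ ⁅heisP n i, heisP n j⁆ := by
      rw [LieHom.map_lie]; rfl
    rw [locP, locP, ← map_mul OreLocalization.numeratorRingHom,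
      ← map_mul OreLocalization.numeratorRingHom, ← map_sub, h2, h1]
    split_ifs
    · rw [map_smul, numerator_smul]; rfl
    · rw [map_zero, map_zero]
  inv := OreLocalization.mul_inv
    (⟨UniversalEnvelopingAlgebra.ι ℂ (heisZ n), Submonoid.mem_powers _⟩ : zPowers n) 1
  central a := by
    induction a using OreLocalization.ind with | _ r s
    change (OreLocalization.oreDiv _ 1) * _ = _ * (OreLocalization.oreDiv _ 1)
    rw [OreLocalization.mul_div_one, OreLocalization.oreDiv_mul_char _ _ _ _
      (UniversalEnvelopingAlgebra.ι ℂ (heisZ n)) s (ι_Z_comm n _).symm, ι_Z_comm, mul_one]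

/-- The homomorphism from the Galilei algebra to the localization of `U(H~)` with
`e ↦ E`, `h ↦ H`, `f ↦ F` (see `oscHom_E`, `oscHom_H`, `oscHom_F`) which is the identity on the
Heisenberg subalgebra (see `oscHom_heis`). -/
noncomputable def oscHom (n : ℕ) : Galilei n →ₗ⁅ℂ⁆ UHeisLoc n :=
  { oscLin n (locP n) (locW n) (locZ n) with
    map_lie' := fun {x y} => oscLin_lie (heisRel_loc n) x y }

theorem oscHom_E (n : ℕ) : oscHom n E = oscE n (locP n) (locW n) := by
  change oscLin n (locP n) (locW n) (locZ n) E = _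
  simp [oscLin, E]

theorem oscHom_H (n : ℕ) : oscHom n H = oscH n (locP n) (locW n) := by
  change oscLin n (locP n) (locW n) (locZ n) H = _
  simp [oscLin, H]

theorem oscHom_F (n : ℕ) : oscHom n F = oscF n (locP n) (locW n) := by
  change oscLin n (locP n) (locW n) (locZ n) F = _
  simp [oscLin, F]

theorem oscHom_heis (n : ℕ) (x : heis n) :
    oscHom n x = OreLocalization.numeratorRingHom (UniversalEnvelopingAlgebra.ι ℂ x) := by
  obtain ⟨x, h1, h2, h3⟩ := x
  have hx : (⟨x, h1, h2, h3⟩ : heis n) =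
      ∑ k : Fin (2 * n + 2), x.p k • heisP n k + x.z • heisZ n := by
    apply Subtype.ext
    change x = (heis n).incl (∑ k : Fin (2 * n + 2), x.p k • heisP n k + x.z • heisZ n)
    rw [map_add, map_sum]
    simp only [map_smul]
    refine (eq_sum x).trans ?_
    rw [h1, h2, h3, zero_smul, zero_smul, zero_smul, zero_add, zero_add, zero_add]
    rfl
  have h : oscHom n x = ∑ k : Fin (2 * n + 2), x.p k • locP n k + x.z • locZ n := by
    change oscLin n (locP n) (locW n) (locZ n) x = _
    simp [oscLin, h1, h2, h3]
  refine h.trans ?_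
  rw [hx, map_add, map_sum, map_add, map_sum]
  simp only [map_smul, numerator_smul]
  rfl

/-- The module `M^g~` of a module `M` over the Heisenberg algebra: induce `M` to the localization
of `U(H~)` at the powers of `z` (the induced module is the module of fractions `m / z ^ i`), and
let the Galilei algebra act through `oscHom`. -/
def Oscillator (n : ℕ) (M : Type*) [AddCommGroup M] [Module ℂ M] [LieRingModule (heis n) M]
    [LieModule ℂ (heis n) M] :=
  OreLocalization (zPowers n) (EnvModule ℂ (heis n) M)

variable (n : ℕ) (M : Type*) [AddCommGroup M] [Module ℂ M] [LieRingModule (heis n) M]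
    [LieModule ℂ (heis n) M]

noncomputable instance : AddCommGroup (Oscillator n M) :=
  inferInstanceAs (AddCommGroup (OreLocalization (zPowers n) (EnvModule ℂ (heis n) M)))
noncomputable instance : Module ℂ (Oscillator n M) :=
  inferInstanceAs (Module ℂ (OreLocalization (zPowers n) (EnvModule ℂ (heis n) M)))
noncomputable instance : Module (UHeisLoc n) (Oscillator n M) :=
  inferInstanceAs (Module (UHeisLoc n) (OreLocalization (zPowers n) (EnvModule ℂ (heis n) M)))
instance : IsScalarTower ℂ (UHeisLoc n) (Oscillator n M) := 
  inferInstanceAs (IsScalarTower ℂ (UHeisLoc n)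
    (OreLocalization (zPowers n) (EnvModule ℂ (heis n) M)))
noncomputable instance : LieRingModule (Galilei n) (Oscillator n M) :=
  letI : LieRingModule (UHeisLoc n) (Oscillator n M) := LieRingModule.ofAssociativeModule
  LieRingModule.compLieHom _ (oscHom n)
instance : LieModule ℂ (Galilei n) (Oscillator n M) :=
  letI : LieRingModule (UHeisLoc n) (Oscillator n M) := LieRingModule.ofAssociativeModule
  letI : LieModule ℂ (UHeisLoc n) (Oscillator n M) := LieModule.ofAssociativeModule
  LieModule.compLieHom _ (oscHom n)

theorem Oscillator.lie_def (x : Galilei n) (m : Oscillator n M) : ⁅x, m⁆ = oscHom n x • m := rfl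
end

end Galilei

/-!
Everything rests on two facts about an irreducible module `M` over a finite-dimensional complex Lie
algebra `L`, where `M` may be infinite-dimensional.

* Schur's lemma (`LieModule.exists_eq_smul_of_commute`): `M` has countable dimension, and an
  operator on a nonzero complex space of countable dimension has nonempty spectrum, since otherwise
  the resolvents applied to a vector would be uncountably many linearly independent vectors. So an
  operator commuting with `L` is a scalar.
* By Jacobson density, a nonzero subspace of `M ⊗ N` that is stable under the action of `L` on the
  first factor contains `M ⊗ v` for some `v ≠ 0` (`LieModule.exists_forall_tmul_mem`).

By Schur's lemma, `z` acts on a simple module by a scalar; if the scalar is nonzero, `M` and its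
localization `M^g~` agree as modules over the Heisenberg algebra. Let `O` be this module.

For the simplicity of `O ⊗ N`, let `W` be a nonzero submodule. The vectors `v` with `O ⊗ v ⊆ W` form
an `sl_2`-submodule of `N`, which is nonzero by the second fact, hence is `N`.

For the second part, let `o` be the action on `V` of the Galilei algebra given by the formulas that
define `M^g~`, which make sense because `z` is invertible on `V`. The original action and `o` agree
on the Heisenberg ideal, so their difference `D` (`Galilei.residual`) commutes with this ideal, and
therefore with all operators `o x`. It follows that `D` is itself a Lie algebra action, which
factors through `sl_2`. It makes `N = Hom(O, V)`, the homomorphisms over the Heisenberg algebra, an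
`sl_2`-module, for which evaluation `O ⊗ N → V` is a homomorphism over the Galilei algebra. It is
injective by the second fact and surjective because `V` is simple; and `N` is simple because
`O ⊗ N` is.
-/

/-! ### Irreducible modules of countable dimension -/

section Schur
open Cardinal Polynomial

/-- If `T` had empty spectrum, every nonzero polynomial in `T` would be invertible, and the
uncountably many vectors `(T - a)⁻¹ m` would be linearly independent. -/
theorem Module.End.spectrum_nonempty_of_rank_le_aleph0 {K M : Type*} [Field K] [IsAlgClosed K]
    [AddCommGroup M] [Module K M] [Nontrivial M] (hK : ℵ₀ < #K) (hM : Module.rank K M ≤ ℵ₀)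
    (T : Module.End K M) : (spectrum K T).Nonempty := by
  classical
  rw [Set.nonempty_iff_ne_empty]
  intro hT
  have hunit : ∀ p : K[X], p ≠ 0 → IsUnit (aeval T p) := by
    intro p hp
    rcases le_or_gt (degree p) 0 with h | h
    · rw [eq_C_of_degree_le_zero h] at hp ⊢
      rw [aeval_C]
      exact (IsUnit.mk0 _ (by simpa using hp)).map _
    · by_contra h0
      have h1 := spectrum.zero_mem (R := K) h0
      rw [spectrum.map_polynomial_aeval_of_degree_pos T p h, hT, Set.image_empty] at h1
      exact h1
  obtain ⟨m, hm⟩ := exists_ne (0 : M)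
  have hinv : ∀ a : K, ∃ y : M, aeval T (X - C a) y = m := fun a =>
    ((Module.End.isUnit_iff _).1 (hunit _ (X_sub_C_ne_zero a))).2 m
  choose y hy using hinv
  have hli : LinearIndependent K y := by
    rw [linearIndependent_iff']
    intro s g hg i hi
    set q : K[X] := ∑ j ∈ s, C (g j) * ∏ k ∈ s.erase j, (X - C k) with hq
    have h1 : aeval T q m = aeval T (∏ k ∈ s, (X - C k)) (∑ j ∈ s, g j • y j) := by
      rw [hq, map_sum, map_sum, LinearMap.sum_apply]
      refine Finset.sum_congr rfl fun j hj => ?_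
      rw [map_smul, ← Finset.prod_erase_mul _ _ hj, map_mul, map_mul, Module.End.mul_apply,
        Module.End.mul_apply, hy, aeval_C, Module.algebraMap_end_apply]
    rw [hg, map_zero] at h1
    have hq0 : q = 0 := by
      by_contra h0
      exact hm (((Module.End.isUnit_iff _).1 (hunit _ h0)).1 (h1.trans (map_zero _).symm))
    have h2 := congrArg (eval i) hq0
    rw [hq, eval_finsetSum, Finset.sum_eq_single i, eval_zero, eval_mul, eval_C, eval_prod] at h2
    · refine (mul_eq_zero.1 h2).resolve_right (Finset.prod_ne_zero_iff.2 fun k hk => ?_)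
      simpa [sub_eq_zero] using (Finset.ne_of_mem_erase hk).symm
    · intro j _ hji
      rw [eval_mul, eval_prod, Finset.prod_eq_zero (Finset.mem_erase.2 ⟨hji.symm, hi⟩) (by simp),
        mul_zero]
    · exact fun h => absurd hi h
  have h3 := hli.cardinal_lift_le_rank
  refine (lift_lt.2 hK).not_ge (h3.trans ?_)
  rw [lift_aleph0, lift_le_aleph0]
  exact hM

namespace LieModule
variable {K L M : Type*} [Field K] [LieRing L] [LieAlgebra K L] [AddCommGroup M] [Module K M]
  [LieRingModule L M] [LieModule K L M]

variable (K L M) in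
/-- The associative algebra of operators on `M` generated by the action of the Lie algebra `L`. -/
abbrev opAlg : Subalgebra K (Module.End K M) := Algebra.adjoin K (Set.range (toEnd K L M))

theorem isSimpleModule_opAlg [hM : IsIrreducible K L M] : IsSimpleModule (opAlg K L M) M := by
  have : Nontrivial M := nontrivial_of_isIrreducible K L M
  rw [isSimpleModule_iff]
  refine IsSimpleOrder.of_forall_eq_top fun W hW => ?_
  let W' : LieSubmodule K L M :=
    { W.restrictScalars K with
      lie_mem := fun {x m} hm =>
        W.smul_mem ⟨toEnd K L M x, Algebra.subset_adjoin ⟨x, rfl⟩⟩ hm }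
  have hW' : W' ≠ ⊥ := fun h => hW (by
    rw [eq_bot_iff]
    intro m hm
    have : m ∈ W' := hm
    rwa [h] at this)
  have := (hM.eq_bot_or_eq_top W').resolve_left hW'
  rw [eq_top_iff]
  intro m _
  change m ∈ W'
  rw [this]
  trivial

/-- An irreducible module is generated by any nonzero vector over the countably generated algebra
`opAlg K L M`. -/
theorem rank_le_aleph0 [Module.Finite K L] [hM : IsIrreducible K L M] :
    Module.rank K M ≤ ℵ₀ := by
  have := isSimpleModule_opAlg (K := K) (L := L) (M := M)
  have : Nontrivial M := nontrivial_of_isIrreducible K L M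
  obtain ⟨m, hm⟩ := exists_ne (0 : M)
  have hb : opAlg K L M =
      Algebra.adjoin K (Set.range fun i => toEnd K L M (Module.finBasis K L i)) := by
    refine le_antisymm (Algebra.adjoin_le ?_) (Algebra.adjoin_mono ?_)
    · rintro _ ⟨x, rfl⟩
      rw [SetLike.mem_coe, ← (Module.finBasis K L).sum_repr x, map_sum]
      simp only [map_smul]
      exact sum_mem fun i _ =>
        Subalgebra.smul_mem _ (Algebra.subset_adjoin (Set.mem_range_self i)) _
    · rintro _ ⟨i, rfl⟩
      exact ⟨_, rfl⟩
  have h1 : Module.rank K (opAlg K L M) ≤ ℵ₀ := by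
    rw [hb]
    exact (Algebra.rank_adjoin_le _).trans (max_le (Set.finite_range _).lt_aleph0.le le_rfl)
  have h2 := IsSimpleModule.toSpanSingleton_surjective (opAlg K L M) hm
  exact (LinearMap.rank_le_of_surjective
    ((LinearMap.toSpanSingleton (opAlg K L M) M m).restrictScalars K) h2).trans h1

/-- **Schur's lemma** over an uncountable algebraically closed field, for irreducible modules of
possibly infinite dimension over a finite-dimensional Lie algebra. -/
theorem exists_eq_smul_of_commute [IsAlgClosed K] [Module.Finite K L] [hM : IsIrreducible K L M]
    (hK : ℵ₀ < #K) (T : Module.End K M) (hT : ∀ (x : L) (m : M), T ⁅x, m⁆ = ⁅x, T m⁆) :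
    ∃ c : K, ∀ m, T m = c • m := by
  have : Nontrivial M := nontrivial_of_isIrreducible K L M
  obtain ⟨c, hc⟩ := T.spectrum_nonempty_of_rank_le_aleph0 hK (rank_le_aleph0 (L := L))
  let S : M →ₗ⁅K,L⁆ M :=
    { algebraMap K (Module.End K M) c - T with
      map_lie' := fun {x m} => by
        change c • ⁅x, m⁆ - T ⁅x, m⁆ = ⁅x, c • m - T m⁆
        rw [hT, lie_sub, lie_smul] }
  have hS : ∀ m, S m = c • m - T m := fun _ => rfl
  refine ⟨c, fun m => ?_⟩
  rcases hM.eq_bot_or_eq_top S.ker with h1 | h1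
  · rcases hM.eq_bot_or_eq_top S.range with h2 | h2
    · have h3 : S m ∈ S.range := ⟨m, rfl⟩
      rw [h2, LieSubmodule.mem_bot, hS, sub_eq_zero] at h3
      exact h3.symm
    · refine absurd ((Module.End.isUnit_iff _).2 ⟨?_, ?_⟩) hc
      · exact (LieModuleHom.ker_eq_bot S).1 h1
      · exact (LieModuleHom.range_eq_top S).1 h2
  · have h3 : m ∈ S.ker := by rw [h1]; trivial
    rw [LieModuleHom.mem_ker, hS, sub_eq_zero] at h3
    exact h3.symm

/-- Jacobson density, in the situation of Schur's lemma. -/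
theorem exists_opAlg_eq [IsAlgClosed K] [Module.Finite K L] [IsIrreducible K L M]
    (hK : ℵ₀ < #K) (f : Module.End K M) (s : Finset M) :
    ∃ a ∈ opAlg K L M, ∀ m ∈ s, a m = f m := by
  have := isSimpleModule_opAlg (K := K) (L := L) (M := M)
  let g : Module.End (Module.End (opAlg K L M) M) M :=
    { f with
      map_smul' := fun T m => by
        obtain ⟨c, hc⟩ := exists_eq_smul_of_commute (L := L) hK (T.restrictScalars K) fun x m =>
          T.map_smul ⟨toEnd K L M x, Algebra.subset_adjoin ⟨x, rfl⟩⟩ m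
        change f (T m) = T (f m)
        have h1 : ∀ m, T m = c • m := hc
        rw [h1, h1, map_smul] }
  obtain ⟨r, hr⟩ := jacobson_density g s
  exact ⟨r, r.2, fun m hm => (hr m hm).symm⟩

/-- A nonzero subspace of `M ⊗ N` stable under the action of `L` on `M` contains `M ⊗ n` for some
nonzero `n`. -/
theorem exists_forall_tmul_mem [IsAlgClosed K] [Module.Finite K L] [IsIrreducible K L M]
    (hK : ℵ₀ < #K) {N : Type*} [AddCommGroup N] [Module K N] (W : Submodule K (M ⊗[K] N))
    (hW : ∀ (x : L), ∀ t ∈ W, (toEnd K L M x).rTensor N t ∈ W) (hW0 : W ≠ ⊥) :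
    ∃ n : N, n ≠ 0 ∧ ∀ m : M, m ⊗ₜ[K] n ∈ W := by
  classical
  have hA : ∀ a ∈ opAlg K L M, ∀ t ∈ W, a.rTensor N t ∈ W := by
    intro a ha
    induction ha using Algebra.adjoin_induction with
    | mem a h =>
      obtain ⟨x, rfl⟩ := h
      exact hW x
    | algebraMap r =>
      intro t ht
      rw [Algebra.algebraMap_eq_smul_one, LinearMap.rTensor_smul, Module.End.one_eq_id,
        LinearMap.rTensor_id]
      exact W.smul_mem r ht
    | add a b _ _ ha hb =>
      intro t ht
      rw [LinearMap.rTensor_add]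
      exact W.add_mem (ha t ht) (hb t ht)
    | mul a b _ _ ha hb =>
      intro t ht
      rw [LinearMap.rTensor_mul]
      exact ha _ (hb t ht)
  obtain ⟨t, ht, ht0⟩ := W.ne_bot_iff.1 hW0
  -- a functional on `M` that does not kill all coefficients of `t` in a basis of `N`
  obtain ⟨ℓ, hℓ⟩ : ∃ ℓ : Module.Dual K M, ℓ.rTensor N t ≠ 0 := by
    let b := Module.Basis.ofVectorSpace K N
    let e := TensorProduct.equivFinsuppOfBasisRight (M := M) b
    obtain ⟨i, hi⟩ : ∃ i, e t i ≠ 0 := by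
      by_contra! h
      exact ht0 (e.injective ((Finsupp.ext h).trans (map_zero e).symm))
    obtain ⟨ℓ, hℓ⟩ := Module.Projective.exists_dual_ne_zero K hi
    have h : ∀ t, b.repr (TensorProduct.lid K N (ℓ.rTensor N t)) i = ℓ (e t i) := by
      intro t
      induction t with
      | zero => simp
      | add t t' h h' => simp only [map_add, Finsupp.add_apply, h, h']
      | tmul m n => simp [e, mul_comm]
    refine ⟨ℓ, fun h0 => hℓ ?_⟩
    rw [← h, h0, map_zero, map_zero, Finsupp.zero_apply]
  obtain ⟨s, hs⟩ := TensorProduct.exists_finset t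
  -- on the coefficients of `t`, some operator `a` of `opAlg` agrees with the operator `ℓ · m` of rank
  -- one, so that `a ⊗ 1` maps `t` to `m ⊗ n`, where `n` is the contraction of `t` with `ℓ`
  refine ⟨TensorProduct.lid K N (ℓ.rTensor N t), by simpa using hℓ, fun m => ?_⟩
  obtain ⟨a, ha, h⟩ := exists_opAlg_eq (L := L) hK (ℓ.smulRight m) (s.image Prod.fst)
  convert hA a ha t ht using 1
  rw [hs, map_sum, map_sum, map_sum, TensorProduct.tmul_sum]
  refine Finset.sum_congr rfl fun i hi => ?_
  rw [LinearMap.rTensor_tmul, LinearMap.rTensor_tmul, TensorProduct.lid_tmul,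
    h _ (Finset.mem_image_of_mem _ hi), LinearMap.smulRight_apply, TensorProduct.tmul_smul,
    TensorProduct.smul_tmul']

end LieModule
end Schur

/-! ### The Galilei algebra and its quotient `sl_2` -/

namespace Galilei
open Cardinal LieModule

instance (n : ℕ) : Module.Finite ℂ (Galilei n) :=
  Module.Finite.equiv (Equiv.linearEquiv ℂ (toProd (n := n))).symm

theorem aleph0_lt_mk_complex : ℵ₀ < #ℂ := by
  rw [Cardinal.mk_complex]
  exact Cardinal.aleph0_lt_continuum

variable {n : ℕ}

theorem toSl2_eq_zero {x : Galilei n} : toSl2 n x = 0 ↔ x ∈ heis n := by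
  have h : toSl2 n x = 0 ↔ (!![x.h, x.e; x.f, -x.h] : Matrix (Fin 2) (Fin 2) ℂ) = 0 :=
    Subtype.ext_iff
  rw [h, ← Matrix.ext_iff]
  simp only [Fin.forall_fin_two]
  change _ ↔ x.e = 0 ∧ x.h = 0 ∧ x.f = 0
  simp
  tauto

/-- The linear section of `toSl2` with values in the span of `e`, `h`, `f`. -/
def ofSl2 (n : ℕ) : sl2 →ₗ[ℂ] Galilei n where
  toFun X := ⟨X.1 0 1, X.1 0 0, X.1 1 0, 0, 0⟩
  map_add' X Y := by ext : 1 <;> simp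
  map_smul' c X := by ext : 1 <;> simp

theorem toSl2_ofSl2 (X : sl2) : toSl2 n (ofSl2 n X) = X := by
  apply Subtype.ext
  change (!![X.1 0 0, X.1 0 1; X.1 1 0, -X.1 0 0] : Matrix (Fin 2) (Fin 2) ℂ) = X.1
  have h : Matrix.trace X.1 = 0 := X.2
  rw [Matrix.trace_fin_two] at h
  rw [← Matrix.ext_iff]
  simp only [Fin.forall_fin_two]
  simp
  linear_combination -h

/-! ### Central characters -/

/-- A central element acts on an irreducible module by a scalar. -/
theorem exists_lie_eq_smul {L M : Type*} [LieRing L] [LieAlgebra ℂ L] [Module.Finite ℂ L]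
    [AddCommGroup M] [Module ℂ M] [LieRingModule L M] [LieModule ℂ L M] [IsIrreducible ℂ L M]
    (z : L) (hz : ∀ x : L, ⁅z, x⁆ = 0) : ∃ c : ℂ, ∀ m : M, ⁅z, m⁆ = c • m := by
  refine exists_eq_smul_of_commute (L := L) aleph0_lt_mk_complex (toEnd ℂ L M z) fun x m => ?_
  change ⁅z, ⁅x, m⁆⁆ = ⁅x, ⁅z, m⁆⁆
  rw [leibniz_lie, hz, zero_lie, zero_add]

theorem heisZ_lie {n : ℕ} (x : heis n) : ⁅heisZ n, x⁆ = 0 := Subtype.ext (lie_Z x.1)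

/-! ### Tensor products with inflated modules -/

section Tensor

/-- The identity map, from an `sl_2`-module to its inflation. -/
def inflationEquiv (N : Type*) [AddCommGroup N] [Module ℂ N] [LieRingModule sl2 N]
    [LieModule ℂ sl2 N] : N ≃ₗ[ℂ] Inflation N := LinearEquiv.refl ℂ N

variable {O N : Type*} [AddCommGroup O] [Module ℂ O] [LieRingModule (Galilei n) O]
  [LieModule ℂ (Galilei n) O] [AddCommGroup N] [Module ℂ N] [LieRingModule sl2 N]
  [LieModule ℂ sl2 N]

theorem lie_inflationEquiv (x : Galilei n) (v : N) :
    ⁅x, inflationEquiv N v⁆ = inflationEquiv N ⁅toSl2 n x, v⁆ := rfl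

theorem lie_tmul_inflation (x : Galilei n) (m : O) (v : N) :
    ⁅x, m ⊗ₜ[ℂ] inflationEquiv N v⁆ =
      ⁅x, m⁆ ⊗ₜ inflationEquiv N v + m ⊗ₜ inflationEquiv N ⁅toSl2 n x, v⁆ := by
  rw [TensorProduct.LieModule.lie_tmul_right, lie_inflationEquiv]

theorem heis_lie_tensor (x : heis n) (t : O ⊗[ℂ] Inflation N) :
    ⁅(x : Galilei n), t⁆ = (toEnd ℂ (heis n) O x).rTensor (Inflation N) t := by
  induction t with
  | zero => simp
  | add t t' h h' => rw [lie_add, h, h', map_add]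
  | tmul m v =>
    obtain ⟨v, rfl⟩ := (inflationEquiv N).surjective v
    rw [lie_tmul_inflation, toSl2_eq_zero.2 x.2, zero_lie, map_zero, TensorProduct.tmul_zero,
      add_zero]
    rfl

theorem exists_forall_tmul_mem_of_ne_bot [IsIrreducible ℂ (heis n) O]
    {W : LieSubmodule ℂ (Galilei n) (O ⊗[ℂ] Inflation N)} (hW : W ≠ ⊥) :
    ∃ v : N, v ≠ 0 ∧ ∀ m : O, m ⊗ₜ[ℂ] inflationEquiv N v ∈ W := by
  refine exists_forall_tmul_mem (L := heis n) aleph0_lt_mk_complex W.toSubmodule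
    (fun x t ht => ?_) (by simpa using hW)
  rw [← heis_lie_tensor]
  exact W.lie_mem ht

/-- A nonzero submodule contains `O ⊗ v` for some nonzero `v`, and the set of all such `v` is
stable under `sl_2`, because `x (m ⊗ v) - x m ⊗ v = m ⊗ x v`. -/
theorem isIrreducible_tensor_inflation [IsIrreducible ℂ (heis n) O]
    [hN : IsIrreducible ℂ sl2 N] : IsIrreducible ℂ (Galilei n) (O ⊗[ℂ] Inflation N) := by
  have : Nontrivial O := nontrivial_of_isIrreducible ℂ (heis n) O
  have : Nontrivial (Inflation N) := nontrivial_of_isIrreducible ℂ sl2 N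
  refine IsIrreducible.mk fun W hW => ?_
  let N' : LieSubmodule ℂ sl2 N :=
    { carrier := {v | ∀ m : O, m ⊗ₜ[ℂ] inflationEquiv N v ∈ W}
      zero_mem' := fun m => by
        rw [map_zero, TensorProduct.tmul_zero]
        exact W.zero_mem
      add_mem' := fun {v v'} hv hv' m => by
        rw [map_add, TensorProduct.tmul_add]
        exact W.add_mem (hv m) (hv' m)
      smul_mem' := fun c v hv m => by
        rw [map_smul, TensorProduct.tmul_smul]
        exact W.smul_mem c (hv m)
      lie_mem := fun {X v} hv m => by
        have h := W.lie_mem (x := ofSl2 n X) (hv m)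
        rw [lie_tmul_inflation, toSl2_ofSl2] at h
        have h2 := W.sub_mem h (hv ⁅ofSl2 n X, m⁆)
        rwa [add_sub_cancel_left] at h2 }
  obtain ⟨v, hv, hvW⟩ := exists_forall_tmul_mem_of_ne_bot hW
  have hN' : N' = ⊤ := (hN.eq_bot_or_eq_top N').resolve_left fun h =>
    hv ((LieSubmodule.eq_bot_iff N').1 h v hvW)
  rw [eq_top_iff]
  intro t _
  induction t with
  | zero => exact W.zero_mem
  | add t t' h h' => exact W.add_mem (h trivial) (h' trivial)
  | tmul m v =>
    obtain ⟨v, rfl⟩ := (inflationEquiv N).surjective v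
    have : v ∈ N' := hN' ▸ LieSubmodule.mem_top _
    exact this m

/-- If `U` is a proper nonzero submodule of `N`, then so is `O ⊗ U` in `O ⊗ N`. -/
theorem isIrreducible_of_tensor_inflation
    [h : IsIrreducible ℂ (Galilei n) (O ⊗[ℂ] Inflation N)] : IsIrreducible ℂ sl2 N := by
  have hnt : Nontrivial (O ⊗[ℂ] Inflation N) := nontrivial_of_isIrreducible ℂ (Galilei n) _
  have : Nontrivial O := not_subsingleton_iff_nontrivial.1 fun _ =>
    not_subsingleton (O ⊗[ℂ] Inflation N) inferInstance
  have : Nontrivial N := not_subsingleton_iff_nontrivial.1 fun _ => by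
    have : Subsingleton (Inflation N) := ‹Subsingleton N›
    exact not_subsingleton (O ⊗[ℂ] Inflation N) inferInstance
  refine IsIrreducible.mk fun U hU => ?_
  obtain ⟨m, hm⟩ := exists_ne (0 : O)
  obtain ⟨ℓ, hℓ⟩ := Module.Projective.exists_dual_eq_one ℂ hm
  let ι : O ⊗[ℂ] U →ₗ[ℂ] O ⊗[ℂ] Inflation N :=
    ((inflationEquiv N).toLinearMap ∘ₗ U.toSubmodule.subtype).lTensor O
  have hι : ∀ (a : O) (v : U), ι (a ⊗ₜ v) = a ⊗ₜ inflationEquiv N v := fun _ _ => rfl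
  let W : LieSubmodule ℂ (Galilei n) (O ⊗[ℂ] Inflation N) :=
    { LinearMap.range ι with
      lie_mem := by
        rintro x _ ⟨t, rfl⟩
        induction t with
        | zero => exact ⟨0, by simp⟩
        | add t t' h h' =>
          rw [map_add, lie_add]
          exact Submodule.add_mem _ h h'
        | tmul a v =>
          refine ⟨⁅x, a⁆ ⊗ₜ v + a ⊗ₜ ⁅toSl2 n x, v⁆, ?_⟩
          rw [map_add, hι, hι, hι, lie_tmul_inflation]
          rfl }
  -- contraction of the first factor with `ℓ`
  let κ : O ⊗[ℂ] Inflation N →ₗ[ℂ] N := (inflationEquiv N).symm.toLinearMap ∘ₗ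
    (TensorProduct.lid ℂ _).toLinearMap ∘ₗ ℓ.rTensor (Inflation N)
  have hκ : ∀ (a : O) (v : N), κ (a ⊗ₜ inflationEquiv N v) = ℓ a • v := fun _ _ => rfl
  have hWU : ∀ t ∈ W, κ t ∈ U := by
    rintro _ ⟨t, rfl⟩
    induction t with
    | zero => simp
    | add t t' h h' =>
      rw [map_add, map_add]
      exact U.add_mem h h'
    | tmul a v =>
      rw [hι, hκ]
      exact U.smul_mem _ v.2
  have hW : W = ⊤ := by
    refine (h.eq_bot_or_eq_top W).resolve_left fun h0 => hU ?_
    rw [LieSubmodule.eq_bot_iff]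
    intro v hv
    have h1 : m ⊗ₜ[ℂ] inflationEquiv N v ∈ W := ⟨m ⊗ₜ ⟨v, hv⟩, rfl⟩
    rw [h0, LieSubmodule.mem_bot] at h1
    rw [← one_smul ℂ v, ← hℓ, ← hκ, h1, map_zero]
  rw [eq_top_iff]
  intro v _
  rw [← one_smul ℂ v, ← hℓ, ← hκ]
  exact hWU _ (hW ▸ LieSubmodule.mem_top _)

end Tensor

/-! ### Localization at a central element acting by a scalar -/

section Oscillator
variable (M : Type*) [AddCommGroup M] [Module ℂ M] [LieRingModule (heis n) M]
  [LieModule ℂ (heis n) M]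

theorem heisZ_pow_smul {c : ℂ} (hz : ∀ m : M, ⁅heisZ n, m⁆ = c • m) (k : ℕ)
    (m : EnvModule ℂ (heis n) M) :
    UniversalEnvelopingAlgebra.ι ℂ (heisZ n) ^ k • m = c ^ k • m := by
  induction k with
  | zero => simp
  | succ k ih =>
    rw [pow_succ', mul_smul, ih, pow_succ', mul_smul]
    exact (EnvModule.ι_smul ℂ (heis n) M (heisZ n) _).trans (hz _)

/-- The map `m ↦ m / 1`. -/
noncomputable def toOscillator : M →ₗ⁅ℂ, heis n⁆ Oscillator n M where
  toFun m := OreLocalization.oreDiv (S := zPowers n) (X := EnvModule ℂ (heis n) M) m 1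
  map_add' _ _ := OreLocalization.add_oreDiv.symm
  map_smul' a m := (OreLocalization.smul_oreDiv_one (S := zPowers n) a
    (X := EnvModule ℂ (heis n) M) m).symm
  map_lie' {x m} := by
    refine Eq.trans ?_ (Oscillator.lie_def n M x _).symm
    rw [oscHom_heis]
    refine Eq.trans ?_ (OreLocalization.smul_div_one (S := zPowers n)).symm
    exact congrArg (fun y : EnvModule ℂ (heis n) M => OreLocalization.oreDiv y (1 : zPowers n))
      (EnvModule.ι_smul ℂ (heis n) M x m).symm

/-- If `z` acts on `M` by a nonzero scalar, passing to fractions `m / z ^ i` does not change the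
module over the Heisenberg algebra. -/
theorem toOscillator_bijective {c : ℂ} (hc : c ≠ 0) (hz : ∀ m : M, ⁅heisZ n, m⁆ = c • m) :
    Function.Bijective (toOscillator (n := n) M) := by
  have hs : ∀ (s : zPowers n), ∃ b : ℂ, b ≠ 0 ∧
      ∀ m : EnvModule ℂ (heis n) M, (s : UHeis n) • m = b • m := by
    rintro ⟨_, k, rfl⟩
    exact ⟨c ^ k, pow_ne_zero k hc, heisZ_pow_smul M hz k⟩
  constructor
  · refine (injective_iff_map_eq_zero _).2 fun m hm => ?_
    have h : OreLocalization.oreDiv (S := zPowers n) (X := EnvModule ℂ (heis n) M) m 1 =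
      OreLocalization.oreDiv 0 1 := hm.trans (OreLocalization.zero_oreDiv _).symm
    obtain ⟨a, r, h1, h2⟩ := OreLocalization.oreDiv_eq_iff.1 h
    obtain ⟨b, hb, hbm⟩ := hs a
    have h3 : (a : UHeis n) = r := by simpa using h2
    rw [smul_zero, ← h3] at h1
    exact (smul_eq_zero.1 (h1.trans (hbm m)).symm).resolve_left hb
  · intro t
    induction t using OreLocalization.ind with | _ m s
    obtain ⟨b, hb, hbm⟩ := hs s
    refine ⟨(b⁻¹ • m : EnvModule ℂ (heis n) M), ?_⟩
    refine (OreLocalization.expand' (b⁻¹ • m : EnvModule ℂ (heis n) M) 1 s).trans ?_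
    rw [mul_one, Submonoid.smul_def, hbm, smul_inv_smul₀ hb]

/-- `toOscillator` as an equivalence. -/
noncomputable def equivOscillator {c : ℂ} (hc : c ≠ 0) (hz : ∀ m : M, ⁅heisZ n, m⁆ = c • m) :
    M ≃ₗ⁅ℂ, heis n⁆ Oscillator n M :=
  { toOscillator M,
    LinearEquiv.ofBijective (toOscillator M).toLinearMap (toOscillator_bijective M hc hz) with }

theorem isIrreducible_oscillator [IsIrreducible ℂ (heis n) M] {c : ℂ} (hc : c ≠ 0)
    (hz : ∀ m : M, ⁅heisZ n, m⁆ = c • m) : IsIrreducible ℂ (heis n) (Oscillator n M) :=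
  (LieSubmodule.orderIsoMapComap (equivOscillator M hc hz).symm).isSimpleOrder

end Oscillator

end Galilei

/-! ### Naturality of the quadratic formulas for `e`, `h`, `f` -/

section OscLin
variable {A B : Type*} [Ring A] [Algebra ℂ A] [Ring B] [Algebra ℂ B]

theorem oscLin_mem {n : ℕ} {p : ℕ → A} {w z : A} (S : Subalgebra ℂ A)
    (hp : ∀ k < 2 * n + 2, p k ∈ S) (hw : w ∈ S) (hz : z ∈ S) (x : Galilei n) :
    oscLin n p w z x ∈ S := by
  have hE : oscE n p w ∈ S := S.mul_mem hw (sum_mem fun k hk => S.smul_mem (by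
    rw [Finset.mem_Icc] at hk
    exact S.mul_mem (hp _ (by omega)) (hp _ (by omega))) _)
  have hF : oscF n p w ∈ S := S.mul_mem hw (sum_mem fun k hk => S.smul_mem (by
    rw [Finset.mem_Icc] at hk
    exact S.mul_mem (hp _ (by omega)) (hp _ (by omega))) _)
  have hH : oscH n p w ∈ S :=
    S.sub_mem (S.smul_mem (S.mul_mem hw (sum_mem fun k hk => S.smul_mem (by
      rw [Finset.mem_range] at hk
      exact S.mul_mem (hp _ (by omega)) (hp _ (by omega))) _)) _) (S.algebraMap_mem _)
  exact S.add_mem (S.add_mem (S.add_mem (S.add_mem (S.smul_mem hE _) (S.smul_mem hH _))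
    (S.smul_mem hF _)) (sum_mem fun k _ => S.smul_mem (hp k k.2) _)) (S.smul_mem hz _)

theorem map_oscLin (n : ℕ) (p : ℕ → A) (w z : A) (g : A →ₐ[ℂ] B) (x : Galilei n) :
    g (oscLin n p w z x) = oscLin n (fun k => g (p k)) (g w) (g z) x := by
  simp [oscLin, oscE, oscF, oscH]

/-- A linear map that intertwines two families of generators intertwines the operators built from
them: the pairs of operators intertwined by `f` form a subalgebra. -/
theorem oscLin_intertwine {X Y : Type*} [AddCommGroup X] [Module ℂ X] [AddCommGroup Y] [Module ℂ Y]
    {n : ℕ} {p : ℕ → Module.End ℂ X} {w z : Module.End ℂ X} {p' : ℕ → Module.End ℂ Y}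
    {w' z' : Module.End ℂ Y} (f : X →ₗ[ℂ] Y)
    (hp : ∀ k < 2 * n + 2, ∀ m, f (p k m) = p' k (f m)) (hw : ∀ m, f (w m) = w' (f m))
    (hz : ∀ m, f (z m) = z' (f m)) (x : Galilei n) (m : X) :
    f (oscLin n p w z x m) = oscLin n p' w' z' x (f m) := by
  let S : Subalgebra ℂ (Module.End ℂ X × Module.End ℂ Y) :=
    { carrier := {a | ∀ m, f (a.1 m) = a.2 (f m)}
      mul_mem' := fun {a b} ha hb m => by
        change f (a.1 (b.1 m)) = a.2 (b.2 (f m))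
        rw [ha, hb]
      add_mem' := fun {a b} ha hb m => by
        change f (a.1 m + b.1 m) = a.2 (f m) + b.2 (f m)
        rw [map_add, ha, hb]
      algebraMap_mem' := fun c m => map_smul f c m }
  have h := oscLin_mem (p := fun k => (p k, p' k)) (w := (w, w')) (z := (z, z')) S hp hw hz x m
  have h1 := map_oscLin n (fun k => (p k, p' k)) (w, w') (z, z') (AlgHom.fst ℂ _ _) x
  have h2 := map_oscLin n (fun k => (p k, p' k)) (w, w') (z, z') (AlgHom.snd ℂ _ _) x
  exact (congrArg (fun a : Module.End ℂ X => f (a m)) h1).symm.trans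
    (h.trans (congrArg (fun a : Module.End ℂ Y => a (f m)) h2))

end OscLin

namespace Galilei
open Cardinal LieModule

theorem lie_mem_heis {n : ℕ} (x : Galilei n) {y : Galilei n} (hy : y ∈ heis n) :
    ⁅x, y⁆ ∈ heis n := by
  rw [← toSl2_eq_zero] at hy ⊢
  rw [LieHom.map_lie, hy, lie_zero]

/-! ### The `sl_2`-action commuting with the Heisenberg subalgebra -/

section Action
attribute [local instance 100] LieRing.ofAssociativeRing

variable (n : ℕ) (V : Type*) [AddCommGroup V] [Module ℂ V] [LieRingModule (Galilei n) V]
  [LieModule ℂ (Galilei n) V]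

/-- The operators on `V` given by the formulas for `M^g~`, with the action of the `p_k` and of `z`
on `V` and with `c⁻¹` for `z⁻¹`. -/
noncomputable def oscEnd (c : ℂ) : Galilei n →ₗ[ℂ] Module.End ℂ V :=
  oscLin n (fun k => toEnd ℂ (Galilei n) V (P k)) (c⁻¹ • 1) (toEnd ℂ (Galilei n) V Z)

/-- The difference of the action of the Galilei algebra on `V` and of `oscEnd`. -/
noncomputable def residual (c : ℂ) : Galilei n →ₗ[ℂ] Module.End ℂ V :=
  (toEnd ℂ (Galilei n) V).toLinearMap - oscEnd n V c

variable {n V}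

theorem residual_apply (c : ℂ) (x : Galilei n) (v : V) :
    residual n V c x v = ⁅x, v⁆ - oscEnd n V c x v := rfl

theorem toEnd_lie_apply (x y : Galilei n) : toEnd ℂ (Galilei n) V ⁅x, y⁆ =
    toEnd ℂ (Galilei n) V x * toEnd ℂ (Galilei n) V y -
      toEnd ℂ (Galilei n) V y * toEnd ℂ (Galilei n) V x := by
  ext v
  exact lie_lie x y v

theorem heisRel_toEnd {c : ℂ} (hc : c ≠ 0) (hz : ∀ v : V, ⁅(Z : Galilei n), v⁆ = c • v) :
    HeisRel n (fun k => toEnd ℂ (Galilei n) V (P k)) (c⁻¹ • 1) (toEnd ℂ (Galilei n) V Z) where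
  comm i j hi hj := by
    rw [← toEnd_lie_apply, lie_P_P i j hi hj]
    split_ifs
    · rw [map_smul]
    · rw [map_zero]
  inv := by
    ext v
    simp [hz, hc]
  central a := by
    ext v
    simp [hz]

theorem oscEnd_lie {c : ℂ} (hc : c ≠ 0) (hz : ∀ v : V, ⁅(Z : Galilei n), v⁆ = c • v)
    (x y : Galilei n) : oscEnd n V c ⁅x, y⁆ =
      oscEnd n V c x * oscEnd n V c y - oscEnd n V c y * oscEnd n V c x :=
  oscLin_lie (heisRel_toEnd hc hz) x y

theorem oscEnd_heis (c : ℂ) {x : Galilei n} (hx : x ∈ heis n) :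
    oscEnd n V c x = toEnd ℂ (Galilei n) V x := by
  obtain ⟨h1, h2, h3⟩ := hx
  conv_rhs => rw [eq_sum x]
  simp [oscEnd, oscLin, h1, h2, h3]

theorem residual_heis (c : ℂ) {x : Galilei n} (hx : x ∈ heis n) : residual n V c x = 0 :=
  sub_eq_zero.2 (oscEnd_heis c hx).symm

/-- Both the action and `oscEnd` have the same commutators with the Heisenberg subalgebra, which
is an ideal on which they agree. -/
theorem residual_heis_lie {c : ℂ} (hc : c ≠ 0) (hz : ∀ v : V, ⁅(Z : Galilei n), v⁆ = c • v)
    (x : Galilei n) (y : heis n) (v : V) :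
    residual n V c x ⁅y, v⁆ = ⁅y, residual n V c x v⁆ := by
  have h := oscEnd_lie hc hz x y
  rw [oscEnd_heis c (lie_mem_heis x y.2), oscEnd_heis c y.2, toEnd_lie_apply] at h
  have h2 := congrArg (fun a : Module.End ℂ V => a v) h
  change ⁅x, ⁅(y : Galilei n), v⁆⁆ - ⁅(y : Galilei n), ⁅x, v⁆⁆ =
    oscEnd n V c x ⁅(y : Galilei n), v⁆ - ⁅(y : Galilei n), oscEnd n V c x v⁆ at h2
  change ⁅x, ⁅(y : Galilei n), v⁆⁆ - oscEnd n V c x ⁅(y : Galilei n), v⁆ =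
    ⁅(y : Galilei n), ⁅x, v⁆ - oscEnd n V c x v⁆
  rw [lie_sub]
  exact sub_eq_sub_iff_sub_eq_sub.2 h2

/-- The operators `oscEnd` are built from the action of the Heisenberg subalgebra, with which
`residual` commutes. -/
theorem residual_oscEnd {c : ℂ} (hc : c ≠ 0) (hz : ∀ v : V, ⁅(Z : Galilei n), v⁆ = c • v)
    (x y : Galilei n) (v : V) :
    residual n V c x (oscEnd n V c y v) = oscEnd n V c y (residual n V c x v) :=
  oscLin_intertwine (residual n V c x)
    (fun k _ v => residual_heis_lie hc hz x (heisP n k) v) (fun v => by simp)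
    (fun v => residual_heis_lie hc hz x (heisZ n) v) y v

/-- As `residual` commutes with `oscEnd`, it respects brackets like the two actions of which it is
the difference. -/
theorem residual_lie {c : ℂ} (hc : c ≠ 0) (hz : ∀ v : V, ⁅(Z : Galilei n), v⁆ = c • v)
    (x y : Galilei n) (v : V) : residual n V c ⁅x, y⁆ v =
      residual n V c x (residual n V c y v) - residual n V c y (residual n V c x v) := by
  have h1 := congrArg (fun a : Module.End ℂ V => a v) (oscEnd_lie hc hz x y)
  change _ = oscEnd n V c x (oscEnd n V c y v) - oscEnd n V c y (oscEnd n V c x v) at h1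
  rw [residual_apply c y v, residual_apply c x v, map_sub, map_sub, residual_oscEnd hc hz,
    residual_oscEnd hc hz]
  simp only [residual_apply, map_sub, lie_lie, h1]
  abel

end Action

/-- A homomorphism over the Heisenberg subalgebra from `M^g~` to `V` also intertwines the quadratic
expressions by which `e`, `h`, `f` act on `M^g~`. -/
theorem oscHom_intertwine {n : ℕ} {M V : Type*} [AddCommGroup M] [Module ℂ M]
    [LieRingModule (heis n) M] [LieModule ℂ (heis n) M] [AddCommGroup V] [Module ℂ V]
    [LieRingModule (Galilei n) V] [LieModule ℂ (Galilei n) V] {c : ℂ} (hc : c ≠ 0)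
    (hz : ∀ v : V, ⁅(Z : Galilei n), v⁆ = c • v) (g : Oscillator n M →ₗ⁅ℂ, heis n⁆ V)
    (x : Galilei n) (m : Oscillator n M) : g ⁅x, m⁆ = oscEnd n V c x (g m) := by
  let ρ : UHeisLoc n →ₐ[ℂ] Module.End ℂ (Oscillator n M) := Algebra.lsmul ℂ ℂ _
  have h1 : ⁅x, m⁆ = oscLin n (fun k => ρ (locP n k)) (ρ (locW n)) (ρ (locZ n)) x m :=
    congrArg (fun a : Module.End ℂ (Oscillator n M) => a m)
      (map_oscLin n (locP n) (locW n) (locZ n) ρ x)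
  have hlie : ∀ (y : heis n) (m : Oscillator n M),
      g ((OreLocalization.numeratorRingHom (UniversalEnvelopingAlgebra.ι ℂ y) : UHeisLoc n) • m) =
        ⁅(y : Galilei n), g m⁆ := by
    intro y m
    rw [← oscHom_heis, ← Oscillator.lie_def]
    exact g.map_lie y m
  rw [h1]
  refine oscLin_intertwine (g : Oscillator n M →ₗ[ℂ] V) (fun k _ m => hlie (heisP n k) m)
    (fun m => ?_) (fun m => hlie (heisZ n) m) x m
  have h2 := hlie (heisZ n) (locW n • m)
  replace h2 := h2.trans (hz _)
  rw [← mul_smul] at h2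
  have h3 : locZ n * locW n = 1 := (heisRel_loc n).inv
  change g ((locZ n * locW n) • m) = _ at h2
  rw [h3, one_smul] at h2
  change g (locW n • m) = c⁻¹ • g m
  rw [h2, inv_smul_smul₀ hc]

/-! ### Multiplicity spaces -/

section Hom
variable {n : ℕ} {O V : Type*} [AddCommGroup O] [Module ℂ O] [LieRingModule (Galilei n) O]
  [LieModule ℂ (Galilei n) O] [AddCommGroup V] [Module ℂ V] [LieRingModule (Galilei n) V]
  [LieModule ℂ (Galilei n) V]

/-- Let `D` be an action of the Galilei algebra on `V` that factors through `sl_2` and commutes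
with the Heisenberg subalgebra. Then `sl_2` acts on the multiplicity space `Hom(O, V)` of
homomorphisms over the Heisenberg subalgebra by composition with `D`. -/
abbrev homLieRingModule (D : Galilei n →ₗ[ℂ] Module.End ℂ V) (hD : ∀ x ∈ heis n, D x = 0)
    (hD' : ∀ (x : Galilei n) (y : heis n) (v : V), D x ⁅y, v⁆ = ⁅y, D x v⁆)
    (hlie : ∀ x y v, D ⁅x, y⁆ v = D x (D y v) - D y (D x v)) :
    LieRingModule sl2 (O →ₗ⁅ℂ, heis n⁆ V) where
  bracket X g :=
    { D (ofSl2 n X) ∘ₗ (g : O →ₗ[ℂ] V) with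
      map_lie' := fun {y m} => by
        change D _ (g ⁅y, m⁆) = ⁅y, D _ (g m)⁆
        rw [LieModuleHom.map_lie, hD'] }
  add_lie X Y g := by
    ext m
    change D (ofSl2 n (X + Y)) (g m) = D (ofSl2 n X) (g m) + D (ofSl2 n Y) (g m)
    rw [map_add, map_add, LinearMap.add_apply]
  lie_add X g g' := by
    ext m
    exact map_add (D (ofSl2 n X)) (g m) (g' m)
  leibniz_lie X Y g := by
    ext m
    change D (ofSl2 n X) (D (ofSl2 n Y) (g m)) =
      D (ofSl2 n ⁅X, Y⁆) (g m) + D (ofSl2 n Y) (D (ofSl2 n X) (g m))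
    have h : ofSl2 n ⁅X, Y⁆ - ⁅ofSl2 n X, ofSl2 n Y⁆ ∈ heis n := by
      rw [← toSl2_eq_zero, map_sub, LieHom.map_lie, toSl2_ofSl2, toSl2_ofSl2, toSl2_ofSl2,
        sub_self]
    have h2 := hD _ h
    rw [map_sub, sub_eq_zero] at h2
    rw [h2, hlie, sub_add_cancel]

end Hom

/-- The hypothesis `hO` says that on `V`, decomposed into copies of `O`, the difference between the
action of `V` and that of `O` is `D`. Then evaluation `O ⊗ Hom(O, V) → V` is an isomorphism. -/
theorem exists_equiv_tensor {n : ℕ} {O V : Type w} [AddCommGroup O] [Module ℂ O]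
    [LieRingModule (Galilei n) O] [LieModule ℂ (Galilei n) O] [AddCommGroup V] [Module ℂ V]
    [LieRingModule (Galilei n) V] [LieModule ℂ (Galilei n) V]
    [IsIrreducible ℂ (heis n) O] [hV : IsIrreducible ℂ (Galilei n) V]
    (D : Galilei n →ₗ[ℂ] Module.End ℂ V) (hD : ∀ x ∈ heis n, D x = 0)
    (hD' : ∀ (x : Galilei n) (y : heis n) (v : V), D x ⁅y, v⁆ = ⁅y, D x v⁆)
    (hlie : ∀ x y v, D ⁅x, y⁆ v = D x (D y v) - D y (D x v))
    (hO : ∀ (g : O →ₗ⁅ℂ, heis n⁆ V) (x : Galilei n) (m : O), ⁅x, g m⁆ = g ⁅x, m⁆ + D x (g m))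
    (g₀ : O →ₗ⁅ℂ, heis n⁆ V) (hg₀ : g₀ ≠ 0) :
    ∃ (N : Type w) (_ : AddCommGroup N) (_ : Module ℂ N) (_ : LieRingModule sl2 N)
      (_ : LieModule ℂ sl2 N), IsIrreducible ℂ sl2 N ∧
        Nonempty (V ≃ₗ⁅ℂ, Galilei n⁆ O ⊗[ℂ] Inflation N) := by
  let N := O →ₗ⁅ℂ, heis n⁆ V
  let i1 : LieRingModule sl2 N := homLieRingModule D hD hD' hlie
  have hact : ∀ (X : sl2) (g : N) (m : O), (⁅X, g⁆ : N) m = D (ofSl2 n X) (g m) :=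
    fun _ _ _ => rfl
  let i2 : LieModule ℂ sl2 N :=
    { smul_lie := fun a X g => by
        ext m
        rw [LieModuleHom.smul_apply, hact, hact, map_smul, map_smul, LinearMap.smul_apply]
      lie_smul := fun a X g => by
        ext m
        exact map_smul (D (ofSl2 n X)) a (g m) }
  let B : O →ₗ[ℂ] Inflation N →ₗ[ℂ] V := LinearMap.mk₂ ℂ
    (fun m g => (inflationEquiv N).symm g m) (fun m m' g => map_add _ m m')
    (fun a m g => map_smul _ a m) (fun m g g' => rfl) (fun a m g => rfl)
  -- evaluation is linear over the Galilei algebra: `hO` accounts for the action on either factor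
  let ev : O ⊗[ℂ] Inflation N →ₗ⁅ℂ, Galilei n⁆ V :=
    { TensorProduct.lift B with
      map_lie' := fun {x t} => by
        change TensorProduct.lift B _ = ⁅x, TensorProduct.lift B t⁆
        induction t with
        | zero => simp
        | add t t' h h' => rw [lie_add, map_add, map_add, lie_add, h, h']
        | tmul m g =>
          obtain ⟨g, rfl⟩ := (inflationEquiv N).surjective g
          rw [lie_tmul_inflation, map_add]
          change g ⁅x, m⁆ + (⁅toSl2 n x, g⁆ : N) m = ⁅x, g m⁆
          have h : ofSl2 n (toSl2 n x) - x ∈ heis n := by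
            rw [← toSl2_eq_zero, map_sub, toSl2_ofSl2, sub_self]
          have h2 := hD _ h
          rw [map_sub, sub_eq_zero] at h2
          rw [hact, h2, hO] }
  have hev : ∀ (m : O) (g : N), ev (m ⊗ₜ inflationEquiv N g) = g m := fun _ _ => rfl
  have hker : ev.ker = ⊥ := by
    by_contra h
    obtain ⟨g, hg, h⟩ := exists_forall_tmul_mem_of_ne_bot h
    refine hg (LieModuleHom.ext fun m => ?_)
    rw [← hev]
    exact h m
  have hrange : ev.range = ⊤ := by
    refine (hV.eq_bot_or_eq_top _).resolve_left fun h => hg₀ (LieModuleHom.ext fun m => ?_)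
    have h1 : g₀ m ∈ ev.range := ⟨m ⊗ₜ inflationEquiv N g₀, hev m g₀⟩
    rwa [h, LieSubmodule.mem_bot] at h1
  have hbij : Function.Bijective ev :=
    ⟨(LieModuleHom.ker_eq_bot ev).1 hker, (LieModuleHom.range_eq_top ev).1 hrange⟩
  let e : O ⊗[ℂ] Inflation N ≃ₗ⁅ℂ, Galilei n⁆ V :=
    { ev, LinearEquiv.ofBijective ev.toLinearMap hbij with }
  have : IsIrreducible ℂ (Galilei n) (O ⊗[ℂ] Inflation N) :=
    (LieSubmodule.orderIsoMapComap e).isSimpleOrder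
  exact ⟨N, inferInstance, inferInstance, i1, i2, 
    isIrreducible_of_tensor_inflation (n := n) (O := O), ⟨e.symm⟩⟩

end Galilei

/-! ### Simple modules with nonzero central charge -/

theorem theorem3 (n : ℕ) :
    (∀ (M : Type u) [AddCommGroup M] [Module ℂ M] [LieRingModule (Galilei.heis n) M]
        [LieModule ℂ (Galilei.heis n) M]
        (N : Type v) [AddCommGroup N] [Module ℂ N] [LieRingModule Galilei.sl2 N]
        [LieModule ℂ Galilei.sl2 N],
        LieModule.IsIrreducible ℂ (Galilei.heis n) M →
        (∃ m : M, ⁅Galilei.heisZ n, m⁆ ≠ 0) →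
        LieModule.IsIrreducible ℂ Galilei.sl2 N →
        LieModule.IsIrreducible ℂ (Galilei n) (Galilei.Oscillator n M ⊗[ℂ] Inflation N)) ∧
    (∀ (V : Type w) [AddCommGroup V] [Module ℂ V] [LieRingModule (Galilei n) V]
        [LieModule ℂ (Galilei n) V],
        LieModule.IsIrreducible ℂ (Galilei n) V →
        (∃ v : V, ⁅(Galilei.Z : Galilei n), v⁆ ≠ 0) →
        ∀ M : LieSubmodule ℂ (Galilei.heis n) V,
          LieModule.IsIrreducible ℂ (Galilei.heis n) M →
          ∃ (N : Type w) (_ : AddCommGroup N) (_ : Module ℂ N) (_ : LieRingModule Galilei.sl2 N)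
            (_ : LieModule ℂ Galilei.sl2 N),
            LieModule.IsIrreducible ℂ Galilei.sl2 N ∧
            Nonempty (V ≃ₗ⁅ℂ, Galilei n⁆ Galilei.Oscillator n M ⊗[ℂ] Inflation N)) := by
  constructor
  · intro M _ _ _ _ N _ _ _ _ hM hz hN
    obtain ⟨c, hc⟩ := Galilei.exists_lie_eq_smul (M := M) (Galilei.heisZ n) Galilei.heisZ_lie
    have hc0 : c ≠ 0 := by
      rintro rfl
      obtain ⟨m, hm⟩ := hz
      exact hm ((hc m).trans (zero_smul ℂ m))
    have := Galilei.isIrreducible_oscillator M hc0 hc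
    exact Galilei.isIrreducible_tensor_inflation
  · intro V _ _ _ _ hV hz M hM
    obtain ⟨c, hc⟩ := Galilei.exists_lie_eq_smul (M := V) (Galilei.Z : Galilei n) Galilei.lie_Z
    have hc0 : c ≠ 0 := by
      rintro rfl
      obtain ⟨v, hv⟩ := hz
      exact hv ((hc v).trans (zero_smul ℂ v))
    have hcM : ∀ m : M, ⁅Galilei.heisZ n, m⁆ = c • m := fun m => Subtype.ext (hc m)
    have := Galilei.isIrreducible_oscillator M hc0 hcM
    let e := Galilei.equivOscillator M hc0 hcM
    refine Galilei.exists_equiv_tensor (Galilei.residual n V c)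
      (fun x hx => Galilei.residual_heis c hx) (Galilei.residual_heis_lie hc0 hc)
      (Galilei.residual_lie hc0 hc) (fun g x m => ?_)
      (M.incl.comp (e.symm : Galilei.Oscillator n M →ₗ⁅ℂ, Galilei.heis n⁆ M)) fun h => ?_
    · rw [Galilei.residual_apply, Galilei.oscHom_intertwine hc0 hc, add_sub_cancel]
    · have : Nontrivial M := LieModule.nontrivial_of_isIrreducible ℂ (Galilei.heis n) M
      obtain ⟨m, hm⟩ := exists_ne (0 : M)
      have h1 := LieModuleHom.congr_fun h (e m)
      change ((e.symm (e m) : M) : V) = 0 at h1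
      rw [LieModuleEquiv.symm_apply_apply] at h1
      exact hm (Subtype.ext h1)
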